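/- Let $k$ be a number field with discriminant $d_k$, let $V(k)$ be its set of places and $\mathbb{A}_k$ its adele ring. For $v \in V(k)$ let $|\cdot|_v$ be the normalized absolute value on $k_v$ (the usual one if $v$ is real, the square of the usual one if $v$ is complex, and $|\pi_v|_v = q_v^{-1}$ for a uniformizer $\pi_v$ if $v$ is finite with residue field of order $q_v$), and let $\mu_{k_v}$ be the Haar measure on $k_v$ with $\mu_{\mathbb{R}}([0,1]) = 1$, $\mu_{\mathbb{C}}([0,1]+i[0,1]) = 2$, and $\mu_{k_v}(\mathcal{O}_v) = 1$ for finite $v$. Let $\mathbf{G}$ be a connected semisimple linear algebraic group over $k$ of dimension $d$, with Lie algebra $\mathfrak{g}$ (its left-invariant vector fields). For an extension field $K$ of $k$ put $\mathfrak{g}_K = \operatorname{Lie}(\mathbf{G}_K)$. For a place $v$ and an ordered basis $e = (e_1,\dots,e_d)$ of $\mathfrak{g}_{k_v}$, let $\mu_{e,v}$ be the measure on $\mathbf{G}(k_v)$ induced by the left-invariant differential form $\omega = e_1^*\wedge\dots\wedge e_d^*$ and by $\mu_{k_v}$; that is, if $\omega = h\, df_1\wedge\dots\wedge df_d$ in local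 coordinates $f_1,\dots,f_d$, then $\mu_{e,v} = |h|_v\, df_1\cdots df_d$, where $df_1\cdots df_d$ is the pullback of $\mu_{k_v}^{\otimes d}$. The Killing measure on $\mathbf{G}(k_v)$ is $$\mu^\dagger_{\mathbf{G}(k_v)} = \sqrt{\bigl|\det\bigl(B(e_i,e_j)\bigr)_{i,j}\bigr|_v}\;\mu_{e,v},$$ where $B$ is the Killing form of $\mathfrak{g}_{k_v}$. The product of measures $\mu_v$ on the groups $\mathbf{G}(k_v)$ is the measure on $\mathbf{G}(\mathbb{A}_k)$ with value $\prod_v \mu_v(E_v)$ on the sets $\mathbf{G}(\mathbb{A}_k) \cap \prod_v E_v$, where the $E_v \subseteq \mathbf{G}(k_v)$ are Borel sets and $E_v = \mathcal{G}(\mathcal{O}_v)$ for almost all finite $v$, for some integral model $\mathcal{G}$ of $\mathbf{G}$. The Tamagawa measure on $\mathbf{G}(\mathbb{A}_k)$ is $\tau = |d_k|^{-d/2}\prod_{v \in V(k)} \mu_{b,v}$ for an ordered basis $b$ of $\mathfrak{g}$ over $k$, which is also regarded as a basis of each $\mathfrak{g}_{k_v}$. Then, for every choice of the basis $b$ of $\mathfrak{g}$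 in the definition of $\tau$ and of the bases $e$ of the Lie algebras $\mathfrak{g}_{k_v}$ in the definition of the Killing measures, the measure $\mu^\dagger = \prod_{v \in V(k)} \mu^\dagger_{\mathbf{G}(k_v)}$ satisfies $$|d_k|^{-d/2}\,\mu^\dagger = \tau .$$ -/

import Mathlib

open scoped TensorProduct NNReal ENNReal
open NumberField IsDedekindDomain MeasureTheory

noncomputable section

namespace AlgGroup

/-! ### Affine algebraic groups

An affine algebraic group `G` over a field `K` is given by its coordinate ring, a commutative Hopf
algebra `B` of finite type over `K`; so `G(R)` is the set of `K`-algebra maps `B → R`, and the base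
change of `G` to an extension field `L` is given by the Hopf algebra `L ⊗[K] B` over `L`. -/

/-- The Zariski topology on the group `G(F) = Hom(B, F)`. The group law is the convolution
product `(g * h)(b) = ∑ g(b₁) h(b₂)`, which Mathlib puts on `WithConv (B →ₐ[F] F)`. -/
@[reducible] def zariskiTopology (F B : Type*) [Field F] [CommRing B] [HopfAlgebra F B] :
    TopologicalSpace (WithConv (B →ₐ[F] F)) :=
  TopologicalSpace.induced
    (fun g => (⟨RingHom.ker g.ofConv, RingHom.ker_isPrime _⟩ : PrimeSpectrum B)) inferInstance

/-- `G` is connected: the group `G(k̄)` is connected in the Zariski topology. -/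
def IsConnectedGroup (k A : Type*) [Field k] [CommRing A] [HopfAlgebra k A] : Prop :=
  letI := zariskiTopology (AlgebraicClosure k) (AlgebraicClosure k ⊗[k] A)
  ConnectedSpace
    (WithConv (AlgebraicClosure k ⊗[k] A →ₐ[AlgebraicClosure k] AlgebraicClosure k))

/-- The radical of `G` is trivial: the only Zariski closed, connected, solvable, normal subgroup
of `G(k̄)` is the trivial one. For a connected group `G` over a field of characteristic zero, this
says that `G` is semisimple. -/
def HasTrivialRadical (k A : Type*) [Field k] [CommRing A] [HopfAlgebra k A] : Prop :=
  letI := zariskiTopology (AlgebraicClosure k) (AlgebraicClosure k ⊗[k] A)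
  ∀ N : Subgroup
      (WithConv (AlgebraicClosure k ⊗[k] A →ₐ[AlgebraicClosure k] AlgebraicClosure k)),
    IsClosed (N : Set
      (WithConv (AlgebraicClosure k ⊗[k] A →ₐ[AlgebraicClosure k] AlgebraicClosure k))) →
    IsConnected (N : Set
      (WithConv (AlgebraicClosure k ⊗[k] A →ₐ[AlgebraicClosure k] AlgebraicClosure k))) →
    N.Normal → Group.IsSolvable N → N = ⊥

/-! ### The Lie algebra -/

section Lie

variable (K B : Type*) [Field K] [CommRing B] [HopfAlgebra K B]

/-- The Lie algebra of `G`: the derivations `D` of the coordinate ring which are invariant under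
all left translations, that is `Δ ∘ D = (id ⊗ D) ∘ Δ`. -/
def lieAlg : LieSubalgebra K (Derivation K B B) where
  carrier := {D | ∀ b, Coalgebra.comul (R := K) (D b) =
    (D : B →ₗ[K] B).lTensor B (Coalgebra.comul (R := K) b)}
  add_mem' := by
    intro D E hD hE b
    simp only [Set.mem_ofPred_eq] at hD hE
    simp [hD b, hE b, LinearMap.lTensor_add]
  zero_mem' := by
    intro b
    simp
  smul_mem' := by
    intro c D hD b
    simp only [Set.mem_ofPred_eq] at hD
    simp [hD b, LinearMap.lTensor_smul]
  lie_mem' := by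
    intro D E hD hE b
    change ∀ b, _ at hD
    change ∀ b, _ at hE
    have key : ((⁅D, E⁆ : Derivation K B B) : B →ₗ[K] B) =
        (D : B →ₗ[K] B) ∘ₗ (E : B →ₗ[K] B) - (E : B →ₗ[K] B) ∘ₗ (D : B →ₗ[K] B) := by
      ext x
      exact Derivation.commutator_apply (D1 := D) (D2 := E) x
    have cD : (Coalgebra.comul (R := K) (A := B)) ∘ₗ (D : B →ₗ[K] B) =
        (D : B →ₗ[K] B).lTensor B ∘ₗ Coalgebra.comul (R := K) := LinearMap.ext hD
    have cE : (Coalgebra.comul (R := K) (A := B)) ∘ₗ (E : B →ₗ[K] B) =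
        (E : B →ₗ[K] B).lTensor B ∘ₗ Coalgebra.comul (R := K) := LinearMap.ext hE
    rw [key]
    have h1 := hD (E b)
    have h2 := hE (D b)
    simp only [Derivation.commutator_apply, map_sub, LinearMap.lTensor_sub, LinearMap.sub_apply,
      LinearMap.lTensor_comp, LinearMap.comp_apply, h1, h2, hD b, hE b]

/-- The determinant of the Gram matrix of the Killing form of `Lie(G)` for a family of vectors. -/
def killingDet {d : ℕ} (e : Fin d → lieAlg K B) : K :=
  (Matrix.of fun i j => killingForm K (lieAlg K B) (e i) (e j)).det

end Lie

/-- The extension `id ⊗ D` of a derivation `D` of `A` to a derivation of `L ⊗ A` over `L`. -/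
def baseChangeDerivation {k A : Type*} (L : Type*) [Field k] [CommRing A] [Algebra k A] [Field L]
    [Algebra k L] (D : Derivation k A A) : Derivation L (L ⊗[k] A) (L ⊗[k] A) :=
  Derivation.mk' ((D : A →ₗ[k] A).baseChange L) (by
    intro x y
    induction x with
    | zero => simp
    | add x₁ x₂ h₁ h₂ => simp only [add_mul, map_add, h₁, h₂, add_smul, smul_add]; abel
    | tmul l a =>
      induction y with
      | zero => simp
      | add y₁ y₂ h₁ h₂ => simp only [mul_add, map_add, h₁, h₂, add_smul, smul_add]; abel
      | tmul m c =>
        simp [Derivation.leibniz, TensorProduct.tmul_add, mul_comm])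

/-! ### Measures on the points over a local field -/

/-- The set `G(K)`, where `B` is the coordinate ring of the `K`-group `G`. -/
def Points (K B : Type*) [Field K] [CommRing B] [Algebra K B] : Type _ := B →ₐ[K] K

section LocalMeasure

variable {K B : Type*} [Field K] [CommRing B] [Algebra K B]

/-- The value of a regular function at a point. -/
def Points.eval (g : Points K B) (b : B) : K := (show B →ₐ[K] K from g) b

variable [TopologicalSpace K]

/-- `G(K)` carries the coarsest topology for which all regular functions are continuous; this is
the subspace topology of any closed embedding of `G` in an affine space. -/
instance : TopologicalSpace (Points K B) := TopologicalSpace.induced Points.eval inferInstance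

instance : MeasurableSpace (Points K B) := borel _

/-- For vector fields `e₁, …, e_d` and functions `f₁, …, f_d` the function `det (eᵢ fⱼ)`; if the
`eᵢ` are a frame with dual coframe `eᵢ*`, then
`df₁ ∧ … ∧ df_d = det (eᵢ fⱼ) • e₁* ∧ … ∧ e_d*`. -/
def jacobian {d : ℕ} (e : Fin d → Derivation K B B) (f : Fin d → B) : B :=
  (Matrix.of fun i j => e i (f j)).det

/-- A coordinate chart on `G(K)`: an open set `U` and regular functions `f₁, …, f_d` such that
`df₁ ∧ … ∧ df_d` vanishes nowhere on `U` and `(f₁, …, f_d)` is injective on `U`. By the inverse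
function theorem over `K`, these charts cover `G(K)`. -/
structure Chart {d : ℕ} (e : Fin d → Derivation K B B) where
  /-- the domain of the chart -/
  U : Set (Points K B)
  /-- the coordinate functions -/
  f : Fin d → B
  isOpen : IsOpen U
  injective : Set.InjOn (fun (g : Points K B) (j : Fin d) => g.eval (f j)) U
  jacobian_ne_zero : ∀ g ∈ U, g.eval (jacobian e f) ≠ 0

variable [MeasurableSpace K]

/-- The measure of the form `e₁* ∧ … ∧ e_d* = det (eᵢ fⱼ)⁻¹ • df₁ ∧ … ∧ df_d` on a chart: the
measure `|det (eᵢ fⱼ)|⁻¹ df₁ ⋯ df_d` on `U`, extended by zero outside `U`. Here `absK` is the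
normalized absolute value on `K`, and `μK` is the chosen Haar measure on `K`. -/
def Chart.measure (absK : K → ℝ≥0) (μK : Measure K) {d : ℕ} {e : Fin d → Derivation K B B}
    (c : Chart e) : Measure (Points K B) :=
  (((Measure.pi fun _ : Fin d => μK).comap
      (fun (g : c.U) (j : Fin d) => g.1.eval (c.f j))).map Subtype.val).withDensity
    fun g => (absK (g.eval (jacobian e c.f)) : ℝ≥0∞)⁻¹

/-- The measure `μ_ω` on `G(K)` induced by the left invariant form `ω = e₁* ∧ … ∧ e_d*`. By the
change of variables formula the measures on the various charts are the restrictions of one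
measure on `G(K)`, and this measure is their supremum, since countably many charts cover `G(K)`. -/
def formMeasure (absK : K → ℝ≥0) (μK : Measure K) {d : ℕ} (e : Fin d → Derivation K B B) :
    Measure (Points K B) :=
  ⨆ c : Chart e, c.measure absK μK

end LocalMeasure

/-- The Killing measure `√|det B(eᵢ, eⱼ)| • μ_ω` on `G(K)`, with `ω = e₁* ∧ … ∧ e_d*`, computed
in an ordered basis `e` of `Lie(G)`. -/
def killingMeasure {K B : Type*} [Field K] [TopologicalSpace K] [MeasurableSpace K] [CommRing B]
    [HopfAlgebra K B] (absK : K → ℝ≥0) (μK : Measure K) {d : ℕ}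
    (e : Module.Basis (Fin d) K (lieAlg K B)) : Measure (Points K B) :=
  NNReal.sqrt (absK (killingDet K B e)) • formMeasure absK μK fun i => (e i : Derivation K B B)

/-! ### The completions of a number field -/

section Completions

variable {k : Type*} [Field k]

instance (v : InfinitePlace k) : MeasurableSpace v.Completion := borel _

instance (v : InfinitePlace k) : BorelSpace v.Completion := ⟨rfl⟩

/-- The normalized absolute value at an infinite place: the usual one at a real place, the square
of the usual one at a complex place. -/
def absInf (v : InfinitePlace k) (x : v.Completion) : ℝ≥0 := ‖x‖₊ ^ v.mult

open scoped Classical in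
/-- The Haar measure on the completion at an infinite place: Lebesgue measure on `ℝ` at a real
place, twice Lebesgue measure on `ℂ` at a complex place. -/
def haarInf (v : InfinitePlace k) : Measure v.Completion :=
  if hv : v.IsReal then
    (volume : Measure ℝ).comap (InfinitePlace.Completion.extensionEmbeddingOfIsReal hv)
  else
    (2 : ℝ≥0∞) • (volume : Measure ℂ).comap (InfinitePlace.Completion.extensionEmbedding v)

variable [NumberField k]

instance (v : HeightOneSpectrum (𝓞 k)) : MeasurableSpace (v.adicCompletion k) := borel _

instance (v : HeightOneSpectrum (𝓞 k)) : BorelSpace (v.adicCompletion k) := ⟨rfl⟩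

/-- The normalized absolute value at a finite place: a uniformizer has absolute value `1 / q`,
where `q` is the number of elements of the residue field. -/
def absFin (v : HeightOneSpectrum (𝓞 k)) (x : v.adicCompletion k) : ℝ≥0 :=
  WithZeroMulInt.toNNReal (HeightOneSpectrum.absNorm_ne_zero v) (Valued.v x)

theorem isCompact_integers (v : HeightOneSpectrum (𝓞 k)) :
    IsCompact (v.adicCompletionIntegers k : Set (v.adicCompletion k)) := by
  have hcl : IsClosed (v.adicCompletionIntegers k : Set (v.adicCompletion k)) :=
    Valued.isClosed_valuationSubring _
  have h1 : CompleteSpace (Valued.integer (v.adicCompletion k)) :=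
    completeSpace_coe_iff_isComplete.mpr hcl.isComplete
  have h2 : IsDiscreteValuationRing (Valued.integer (v.adicCompletion k)) :=
    inferInstanceAs (IsDiscreteValuationRing (v.adicCompletionIntegers k))
  have h3 : Finite (IsLocalRing.ResidueField (Valued.integer (v.adicCompletion k))) := by
    have : Finite (𝓞 k ⧸ v.asIdeal) := v.asIdeal.finiteQuotientOfFreeOfNeBot v.ne_bot
    let q : 𝓞 k → IsLocalRing.ResidueField (Valued.integer (v.adicCompletion k)) := fun r =>
      IsLocalRing.residue _ ⟨(algebraMap (𝓞 k) (v.adicCompletionIntegers k) r).1,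
        (algebraMap (𝓞 k) (v.adicCompletionIntegers k) r).2⟩
    have key : ∀ x y : Valued.integer (v.adicCompletion k),
        Valued.v ((x : v.adicCompletion k) - y) < 1 →
        IsLocalRing.residue _ x = IsLocalRing.residue _ y := by
      intro x y hxy
      rw [← sub_eq_zero, ← map_sub, IsLocalRing.residue_eq_zero_iff,
        IsLocalRing.mem_maximalIdeal, mem_nonunits_iff,
        Valuation.Integer.not_isUnit_iff_valuation_lt_one]
      exact hxy
    have hsm : ∀ r s : 𝓞 k, r - s ∈ v.asIdeal →
        Valued.v ((algebraMap (𝓞 k) (v.adicCompletionIntegers k) r : v.adicCompletion k) -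
          (algebraMap (𝓞 k) (v.adicCompletionIntegers k) s : v.adicCompletion k)) < 1 := by
      intro r s hrs
      rw [← AddSubgroupClass.coe_sub, ← map_sub,
        HeightOneSpectrum.algebraMap_adicCompletionIntegers_apply,
        HeightOneSpectrum.valuedAdicCompletion_eq_valuation']
      exact (v.valuation_lt_one_iff_mem (r - s)).mpr hrs
    have hval : ∀ y : k, Valued.v (algebraMap k (v.adicCompletion k) y) = v.valuation k y := by
      intro y
      rw [HeightOneSpectrum.algebraMap_adicCompletion]
      exact HeightOneSpectrum.valuedAdicCompletion_eq_valuation' v y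
    refine Finite.of_surjective (fun c : 𝓞 k ⧸ v.asIdeal => q c.out) fun z => ?_
    obtain ⟨x, rfl⟩ := IsLocalRing.residue_surjective z
    have hopen : IsOpen {z : v.adicCompletion k | Valued.v ((x : v.adicCompletion k) - z) < 1} :=
      by
        have h := (Valued.isOpen_ball (v.adicCompletion k) 1).preimage
          (continuous_const.sub continuous_id : Continuous fun z => (x : v.adicCompletion k) - z)
        simpa [Set.preimage, Valuation.restrict_lt_one_iff] using h
    obtain ⟨y, hy⟩ := (HeightOneSpectrum.denseRange_algebraMap k v).exists_mem_open hopen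
      ⟨(x : v.adicCompletion k), by simp⟩
    rw [Set.mem_ofPred_eq] at hy
    have hy1 : v.valuation k y ≤ 1 := by
      rw [← hval]
      have := Valuation.map_sub Valued.v (x : v.adicCompletion k)
        ((x : v.adicCompletion k) - algebraMap k (v.adicCompletion k) y)
      rw [sub_sub_cancel] at this
      exact this.trans (max_le x.2 hy.le)
    obtain ⟨a, ha⟩ := v.exists_valuation_sub_lt_of_integer hy1 1
    refine ⟨Ideal.Quotient.mk v.asIdeal a, Eq.trans (b := q a) (key _ _ ?_) (key _ _ ?_)⟩
    · refine hsm _ _ ?_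
      rw [← Ideal.Quotient.eq, Ideal.Quotient.mk_out]
    · rw [← hval, map_sub] at ha
      have := Valuation.map_add_lt Valued.v (g := 1) ha ((Valuation.map_sub_swap _ _ _).trans_lt hy)
      rw [sub_add_sub_cancel] at this
      exact this
  have h4 := Valued.integer.compactSpace_iff_completeSpace_and_isDiscreteValuationRing_and_finite_residueField.mpr
    ⟨h1, h2, h3⟩
  exact isCompact_iff_compactSpace.mpr h4

/-- The ring of integers of `k_v`, as a compact set with nonempty interior. -/
def integersCompacts (v : HeightOneSpectrum (𝓞 k)) :
    TopologicalSpace.PositiveCompacts (v.adicCompletion k) where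
  carrier := v.adicCompletionIntegers k
  isCompact' := isCompact_integers v
  interior_nonempty' := by
    have h : IsOpen (v.adicCompletionIntegers k : Set (v.adicCompletion k)) :=
      Valued.isOpen_valuationSubring _
    rw [h.interior_eq]
    exact ⟨0, zero_mem _⟩

/-- The Haar measure on the completion at a finite place for which the ring of integers has
measure one. -/
def haarFin (v : HeightOneSpectrum (𝓞 k)) : Measure (v.adicCompletion k) :=
  Measure.addHaarMeasure (integersCompacts v)

end Completions

/-! ### Adelic points and product measures -/

section Adelic

variable (k A : Type*) [Field k] [NumberField k] [CommRing A] [Algebra k A]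

/-- The group `G(𝔸_k)`, where `A` is the coordinate ring of `G`. -/
def AdelicPoints : Type _ := A →ₐ[k] AdeleRing (𝓞 k) k

variable {k}

/-- The projection from the adeles to the completion at an infinite place. -/
def adeleToInf (v : InfinitePlace k) : AdeleRing (𝓞 k) k →ₐ[k] v.Completion where
  toFun x := x.1 v
  map_one' := rfl
  map_mul' _ _ := rfl
  map_zero' := rfl
  map_add' _ _ := rfl
  commutes' _ := rfl

/-- The projection from the adeles to the completion at a finite place. -/
def adeleToFin (v : HeightOneSpectrum (𝓞 k)) : AdeleRing (𝓞 k) k →ₐ[k] v.adicCompletion k where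
  toFun x := x.2 v
  map_one' := rfl
  map_mul' _ _ := rfl
  map_zero' := rfl
  map_add' _ _ := rfl
  commutes' _ := rfl

variable {A}

/-- The projection `G(𝔸_k) → G(k_v)` for an infinite place. -/
def AdelicPoints.projInf (g : AdelicPoints k A) (v : InfinitePlace k) :
    Points v.Completion (v.Completion ⊗[k] A) :=
  Algebra.TensorProduct.lift (AlgHom.id v.Completion v.Completion)
    ((adeleToInf v).comp (show A →ₐ[k] AdeleRing (𝓞 k) k from g)) fun _ _ => Commute.all _ _

/-- The projection `G(𝔸_k) → G(k_v)` for a finite place. -/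
def AdelicPoints.projFin (g : AdelicPoints k A) (v : HeightOneSpectrum (𝓞 k)) :
    Points (v.adicCompletion k) (v.adicCompletion k ⊗[k] A) :=
  Algebra.TensorProduct.lift (AlgHom.id (v.adicCompletion k) (v.adicCompletion k))
    ((adeleToFin v).comp (show A →ₐ[k] AdeleRing (𝓞 k) k from g)) fun _ _ => Commute.all _ _

/-- The σ-algebra on `G(𝔸_k)` generated by the projections to all `G(k_v)`. As `G(𝔸_k)` is second
countable with countably many places, it is the Borel σ-algebra of the adelic topology. -/
instance : MeasurableSpace (AdelicPoints k A) :=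
  (⨆ v : InfinitePlace k, MeasurableSpace.comap (fun g => g.projInf v) inferInstance) ⊔
  (⨆ v : HeightOneSpectrum (𝓞 k), MeasurableSpace.comap (fun g => g.projFin v) inferInstance)

/-- The points of `G(k_v)` at which all functions in `X` are integral. If `X` generates the
coordinate ring, this is `𝒢(𝒪_v)` for the integral model `𝒢` of `G` given by `X`. -/
def integralPoints (X : Finset A) (v : HeightOneSpectrum (𝓞 k)) :
    Set (Points (v.adicCompletion k) (v.adicCompletion k ⊗[k] A)) :=
  {g | ∀ x ∈ X, g.eval (1 ⊗ₜ x) ∈ v.adicCompletionIntegers k}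

variable (k A)

/-- A family of Borel sets `E_v ⊆ G(k_v)` such that `E_v = 𝒢(𝒪_v)` for almost all `v`, where `𝒢`
is some integral model of `G` (any two integral models agree at almost all places). -/
structure Box where
  /-- the components at the infinite places -/
  inf : ∀ v : InfinitePlace k, Set (Points v.Completion (v.Completion ⊗[k] A))
  /-- the components at the finite places -/
  fin : ∀ v : HeightOneSpectrum (𝓞 k),
    Set (Points (v.adicCompletion k) (v.adicCompletion k ⊗[k] A))
  measurableSet_inf : ∀ v, MeasurableSet (inf v)
  measurableSet_fin : ∀ v, MeasurableSet (fin v)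
  integral : ∃ X : Finset A, Algebra.adjoin k (X : Set A) = ⊤ ∧
    ∀ᶠ v in Filter.cofinite, fin v = integralPoints X v

variable {k A}

/-- The subset `G(𝔸_k) ∩ ∏ E_v` of `G(𝔸_k)`. -/
def Box.toSet (E : Box k A) : Set (AdelicPoints k A) :=
  {g | (∀ v, g.projInf v ∈ E.inf v) ∧ ∀ v, g.projFin v ∈ E.fin v}

variable (μInf : ∀ v : InfinitePlace k, Measure (Points v.Completion (v.Completion ⊗[k] A)))
  (μFin : ∀ v : HeightOneSpectrum (𝓞 k),
    Measure (Points (v.adicCompletion k) (v.adicCompletion k ⊗[k] A)))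

/-- The product `∏ μ_v(E_v)` over all places, as a limit of the products over finite sets of
places. -/
def Box.volume (E : Box k A) : ℝ≥0∞ :=
  (∏ v, μInf v (E.inf v)) *
    Filter.liminf (fun S : Finset (HeightOneSpectrum (𝓞 k)) => ∏ v ∈ S, μFin v (E.fin v))
      Filter.atTop

/-- The outer measure on `G(𝔸_k)` given by coverings with countably many boxes. -/
def productOuterMeasure : OuterMeasure (AdelicPoints k A) :=
  OuterMeasure.boundedBy fun s => ⨅ (E : Box k A) (_ : E.toSet = s), E.volume μInf μFin

theorem liminf_add_liminf_le {ι : Type*} (l : Filter ι) (u w : ι → ℝ≥0∞) :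
    Filter.liminf u l + Filter.liminf w l ≤ Filter.liminf (fun i => u i + w i) l := by
  rw [Filter.liminf_eq, Filter.liminf_eq, sSup_eq_iSup, sSup_eq_iSup]
  refine ENNReal.biSup_add_biSup_le' ⟨0, by simp⟩ ⟨0, by simp⟩ fun a ha b hb => ?_
  refine Filter.le_liminf_of_le (by isBoundedDefault) ?_
  filter_upwards [ha, hb] with i h1 h2
  exact add_le_add h1 h2

theorem prod_update_inter_add_diff {ι : Type*} [DecidableEq ι] {X : ι → Type*}
    [∀ i, MeasurableSpace (X i)] (μ : ∀ i, Measure (X i)) (F : ∀ i, Set (X i)) (S : Finset ι)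
    {i : ι} (hi : i ∈ S) {t : Set (X i)} (ht : MeasurableSet t) :
    ∏ j ∈ S, μ j (Function.update F i (F i ∩ t) j) +
      ∏ j ∈ S, μ j (Function.update F i (F i \ t) j) = ∏ j ∈ S, μ j (F j) := by
  have h : ∀ u : Set (X i), ∏ j ∈ S, μ j (Function.update F i u j) =
      μ i u * ∏ j ∈ S.erase i, μ j (F j) := by
    intro u
    rw [← Finset.mul_prod_erase S _ hi, Function.update_self]
    congr 1
    refine Finset.prod_congr rfl fun j hj => ?_
    rw [Function.update_of_ne (Finset.ne_of_mem_erase hj)]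
  rw [h, h, ← add_mul, measure_inter_add_sdiff _ ht, Finset.mul_prod_erase S (fun j => μ j (F j)) hi]

open scoped Classical in
/-- Change one infinite component of a box. -/
def Box.updateInf (E : Box k A) (v : InfinitePlace k)
    (t : Set (Points v.Completion (v.Completion ⊗[k] A))) (ht : MeasurableSet t) : Box k A where
  inf := Function.update E.inf v t
  fin := E.fin
  measurableSet_inf w := by
    rcases eq_or_ne w v with rfl | h
    · rwa [Function.update_self]
    · rw [Function.update_of_ne h]; exact E.measurableSet_inf w
  measurableSet_fin := E.measurableSet_fin
  integral := E.integral

open scoped Classical in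
/-- Change one finite component of a box. -/
def Box.updateFin (E : Box k A) (v : HeightOneSpectrum (𝓞 k))
    (t : Set (Points (v.adicCompletion k) (v.adicCompletion k ⊗[k] A))) (ht : MeasurableSet t) :
    Box k A where
  inf := E.inf
  fin := Function.update E.fin v t
  measurableSet_inf := E.measurableSet_inf
  measurableSet_fin w := by
    rcases eq_or_ne w v with rfl | h
    · rwa [Function.update_self]
    · rw [Function.update_of_ne h]; exact E.measurableSet_fin w
  integral := by
    obtain ⟨X, hX, h⟩ := E.integral
    refine ⟨X, hX, ?_⟩
    filter_upwards [h, (Set.finite_singleton v).compl_mem_cofinite] with w hw hne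
    rw [Function.update_of_ne hne, hw]

theorem Box.mem_updateInf (E : Box k A) (v : InfinitePlace k)
    (t : Set (Points v.Completion (v.Completion ⊗[k] A))) (ht : MeasurableSet t)
    (hE : t ⊆ E.inf v) (g : AdelicPoints k A) :
    g ∈ (E.updateInf v t ht).toSet ↔ g ∈ E.toSet ∧ g.projInf v ∈ t := by
  classical
  constructor
  · rintro ⟨h1, h2⟩
    have hv : g.projInf v ∈ t := by simpa [Box.updateInf] using h1 v
    refine ⟨⟨fun w => ?_, h2⟩, hv⟩
    rcases eq_or_ne w v with rfl | h
    · exact hE hv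
    · simpa [Box.updateInf, Function.update_of_ne h] using h1 w
  · rintro ⟨⟨h1, h2⟩, hv⟩
    refine ⟨fun w => ?_, h2⟩
    rcases eq_or_ne w v with rfl | h
    · simpa [Box.updateInf] using hv
    · simpa [Box.updateInf, Function.update_of_ne h] using h1 w

theorem Box.mem_updateFin (E : Box k A) (v : HeightOneSpectrum (𝓞 k))
    (t : Set (Points (v.adicCompletion k) (v.adicCompletion k ⊗[k] A))) (ht : MeasurableSet t)
    (hE : t ⊆ E.fin v) (g : AdelicPoints k A) :
    g ∈ (E.updateFin v t ht).toSet ↔ g ∈ E.toSet ∧ g.projFin v ∈ t := by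
  classical
  constructor
  · rintro ⟨h1, h2⟩
    have hv : g.projFin v ∈ t := by simpa [Box.updateFin] using h2 v
    refine ⟨⟨h1, fun w => ?_⟩, hv⟩
    rcases eq_or_ne w v with rfl | h
    · exact hE hv
    · simpa [Box.updateFin, Function.update_of_ne h] using h2 w
  · rintro ⟨⟨h1, h2⟩, hv⟩
    refine ⟨h1, fun w => ?_⟩
    rcases eq_or_ne w v with rfl | h
    · simpa [Box.updateFin] using hv
    · simpa [Box.updateFin, Function.update_of_ne h] using h2 w

theorem le_caratheodory :
    (inferInstance : MeasurableSpace (AdelicPoints k A)) ≤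
      (productOuterMeasure μInf μFin).caratheodory := by
  classical
  refine sup_le (iSup_le fun v => ?_) (iSup_le fun v => ?_)
  · rintro _ ⟨t, ht, rfl⟩
    refine OuterMeasure.boundedBy_caratheodory fun u => le_iInf₂ fun E hE => ?_
    subst hE
    have m1 := (E.measurableSet_inf v).inter ht
    have m2 := (E.measurableSet_inf v).diff ht
    refine (add_le_add
      (iInf₂_le (E.updateInf v _ m1) (Set.ext fun g => ?_))
      (iInf₂_le (E.updateInf v _ m2) (Set.ext fun g => ?_))).trans ?_
    · rw [E.mem_updateInf v _ m1 Set.inter_subset_left]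
      exact ⟨fun h => ⟨h.1, h.2.2⟩, fun h => ⟨h.1, h.1.1 v, h.2⟩⟩
    · rw [E.mem_updateInf v _ m2 Set.sdiff_subset]
      exact ⟨fun h => ⟨h.1, h.2.2⟩, fun h => ⟨h.1, h.1.1 v, h.2⟩⟩
    · simp only [Box.volume, Box.updateInf]
      rw [← add_mul, prod_update_inter_add_diff μInf E.inf Finset.univ (Finset.mem_univ v) ht]
  · rintro _ ⟨t, ht, rfl⟩
    refine OuterMeasure.boundedBy_caratheodory fun u => le_iInf₂ fun E hE => ?_
    subst hE
    have m1 := (E.measurableSet_fin v).inter ht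
    have m2 := (E.measurableSet_fin v).diff ht
    refine (add_le_add
      (iInf₂_le (E.updateFin v _ m1) (Set.ext fun g => ?_))
      (iInf₂_le (E.updateFin v _ m2) (Set.ext fun g => ?_))).trans ?_
    · rw [E.mem_updateFin v _ m1 Set.inter_subset_left]
      exact ⟨fun h => ⟨h.1, h.2.2⟩, fun h => ⟨h.1, h.1.2 v, h.2⟩⟩
    · rw [E.mem_updateFin v _ m2 Set.sdiff_subset]
      exact ⟨fun h => ⟨h.1, h.2.2⟩, fun h => ⟨h.1, h.1.2 v, h.2⟩⟩
    · simp only [Box.volume, Box.updateFin]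
      rw [← mul_add]
      refine mul_le_mul_right ((liminf_add_liminf_le _ _ _).trans (Filter.liminf_le_liminf ?_)) _
      filter_upwards [Filter.eventually_ge_atTop {v}] with S hS
      exact (prod_update_inter_add_diff μFin E.fin S (hS (Finset.mem_singleton_self v)) ht).le

/-- The product measure `∏ μ_v` on `G(𝔸_k)`, obtained by Carathéodory's extension from the boxes
`∏ E_v` with their volumes `∏ μ_v(E_v)`. -/
def productMeasure : Measure (AdelicPoints k A) :=
  (productOuterMeasure μInf μFin).toMeasure (le_caratheodory μInf μFin)

end Adelic

/-! ### The two measures -/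

section Main

variable {k A : Type*} [Field k] [NumberField k] [CommRing A] [HopfAlgebra k A] {d : ℕ}

/-- The Tamagawa measure `|d_k|^{-d/2} ∏ μ_{ω,v}` on `G(𝔸_k)`, computed with the invariant form
`ω = b₁* ∧ … ∧ b_d*` over `k`, where `b` is an ordered basis of the Lie algebra of `G`. -/
def tamagawaMeasure (b : Module.Basis (Fin d) k (lieAlg k A)) : Measure (AdelicPoints k A) :=
  ENNReal.ofReal ((|discr k| : ℝ) ^ (-(d : ℝ) / 2)) •
    productMeasure
      (fun v => formMeasure (absInf v) (haarInf v) fun i =>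
        baseChangeDerivation v.Completion (b i : Derivation k A A))
      (fun v => formMeasure (absFin v) (haarFin v) fun i =>
        baseChangeDerivation (v.adicCompletion k) (b i : Derivation k A A))

/-- The product `∏ μ†_{G(k_v)}` of the local Killing measures on `G(𝔸_k)`, computed in ordered
bases of the Lie algebras of the groups `G` over `k_v`. -/
def killingProductMeasure
    (eInf : ∀ v : InfinitePlace k,
      Module.Basis (Fin d) v.Completion (lieAlg v.Completion (v.Completion ⊗[k] A)))
    (eFin : ∀ v : HeightOneSpectrum (𝓞 k), Module.Basis (Fin d) (v.adicCompletion k)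
      (lieAlg (v.adicCompletion k) (v.adicCompletion k ⊗[k] A))) :
    Measure (AdelicPoints k A) :=
  productMeasure (fun v => killingMeasure (absInf v) (haarInf v) (eInf v))
    (fun v => killingMeasure (absFin v) (haarFin v) (eFin v))

end Main

end AlgGroup

end

open AlgGroup

/-! Replacing a basis of the Lie algebra over `k_v` by its image under a matrix `P` multiplies the
form measure by `|det P|⁻¹` and the Gram determinant of the Killing form by `(det P)²`. The Killing
measure is therefore independent of the basis (`killingMeasure_eq_of_basis`), and the global basis
`b` may be used at every place. Extension of scalars keeps the structure constants, so the local
Gram determinants are all the image of one `δ ∈ k`, and the local Killing measure is `√|δ|_v` times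
the local measure of the form given by `b` (`killingMeasure_baseChange`). If `δ ≠ 0`, the product
formula says that these factors have product one, so the product measure does not change
(`productMeasure_smul`).

The substantial point is `δ ≠ 0` (`killingDet_ne_zero`), where semisimplicity, stated through
subgroups of `G(k̄)`, must give a nondegenerate Killing form. By Cartan's criterion it suffices that
the Lie algebra over `k̄` has trivial radical (`radical_lieAlg_eq_bot`). Otherwise the last nonzero
term of the derived series of the radical is a nonzero abelian ideal `I`, stable under the adjoint
action. Let `Z` be the center of the centralizer of `I` in `G(k̄)`; it is closed, normal and
commutative, so its identity component is trivial by hypothesis. For `D ≠ 0` in `I`, however, the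
functions whose derivatives along `D` all vanish at the identity form a prime ideal. Its zero locus,
the closure of the formal one-parameter group of `D`, is irreducible, contains the identity and lies
in `Z`, and by the Nullstellensatz it has a second point.

Invariant derivations are handled through functionals on the coordinate ring: `D` is right
convolution with its value at the identity, and brackets, translations and centralizers become
computations in the convolution algebra. -/

noncomputable section

namespace AlgGroup

/-! ### Dependence of the form measure on the frame -/

section Scaling

variable {K B : Type*} [Field K] [CommRing B] [Algebra K B]

@[simp]
theorem Points.eval_smul (g : Points K B) (u : K) (b : B) : g.eval (u • b) = u * g.eval b :=
  map_smul (show B →ₐ[K] K from g) u b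

theorem jacobian_matrix_smul {d : ℕ} {e e' : Fin d → Derivation K B B}
    (P : Matrix (Fin d) (Fin d) K) (h : ∀ i, e' i = ∑ m, P i m • e m) (f : Fin d → B) :
    jacobian e' f = P.det • jacobian e f := by
  have : (Matrix.of fun i j => e' i (f j)) =
      P.map (algebraMap K B) * (Matrix.of fun i j => e i (f j)) := by
    ext i j
    have hs : ∀ s : Finset (Fin d), (∑ m ∈ s, P i m • e m) (f j) = ∑ m ∈ s, P i m • e m (f j) := by
      intro s
      induction s using Finset.induction_on with
      | empty => simp
      | insert a s ha ih =>
        rw [Finset.sum_insert ha, Finset.sum_insert ha, Derivation.add_apply,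
          Derivation.smul_apply, ih]
    simp [h, hs, Matrix.mul_apply, Algebra.smul_def]
  rw [jacobian, this, Matrix.det_mul, Algebra.smul_def, jacobian]
  congr 1
  exact ((algebraMap K B).map_det P).symm

variable [TopologicalSpace K]

/-- A chart for a frame `e` is a chart for every frame whose jacobians are proportional. -/
def Chart.ofSMul {d : ℕ} {e e' : Fin d → Derivation K B B} {u : K} (hu : u ≠ 0)
    (h : ∀ f, jacobian e' f = u • jacobian e f) (c : Chart e) : Chart e' where
  U := c.U
  f := c.f
  isOpen := c.isOpen
  injective := c.injective
  jacobian_ne_zero g hg := by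
    rw [h, Points.eval_smul]
    exact mul_ne_zero hu (c.jacobian_ne_zero g hg)

variable [MeasurableSpace K]

theorem Chart.measure_ofSMul (absK : K →*₀ ℝ≥0) (μK : Measure K) {d : ℕ}
    {e e' : Fin d → Derivation K B B} {u : K} (hu : u ≠ 0)
    (h : ∀ f, jacobian e' f = u • jacobian e f) (c : Chart e) :
    (c.ofSMul hu h).measure absK μK = (absK u : ℝ≥0∞)⁻¹ • c.measure absK μK := by
  have hu' : (absK u : ℝ≥0∞) ≠ 0 := by simpa using hu
  -- `withDensity_smul'` asks for a finite constant instead of a measurable density.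
  rw [Chart.measure, Chart.measure, ← withDensity_smul' _ _ (ENNReal.inv_ne_top.2 hu')]
  congr 1
  ext g
  simp only [Chart.ofSMul, h, Points.eval_smul, map_mul, ENNReal.coe_mul, Pi.smul_apply,
    smul_eq_mul]
  rw [ENNReal.mul_inv (Or.inl hu') (Or.inl ENNReal.coe_ne_top)]

/-- A chart for `e` is also one for `e'`, with density scaled by `|u|⁻¹`, so each term of the
supremum on the left is bounded by the right side. Equality follows by applying this to `u⁻¹` as
well; no gluing of charts is needed. -/
theorem smul_formMeasure_le (absK : K →*₀ ℝ≥0) (μK : Measure K) {d : ℕ}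
    {e e' : Fin d → Derivation K B B} {u : K} (hu : u ≠ 0)
    (h : ∀ f, jacobian e' f = u • jacobian e f) :
    formMeasure absK μK e ≤ (absK u : ℝ≥0∞) • formMeasure absK μK e' := by
  have hu' : (absK u : ℝ≥0∞) ≠ 0 := by simpa using hu
  refine iSup_le fun c => ?_
  have := le_iSup (fun c : Chart e' => c.measure absK μK) (c.ofSMul hu h)
  simp only [Chart.measure_ofSMul] at this
  calc c.measure absK μK = (absK u : ℝ≥0∞) • (absK u : ℝ≥0∞)⁻¹ • c.measure absK μK := by
        rw [smul_smul, ENNReal.mul_inv_cancel hu' ENNReal.coe_ne_top, one_smul]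
    _ ≤ _ := by
        rw [Measure.le_iff]
        intro s _
        simp only [Measure.smul_apply]
        have := this s
        simp only [Measure.smul_apply] at this
        exact mul_le_mul_right this _

theorem formMeasure_eq_smul (absK : K →*₀ ℝ≥0) (μK : Measure K) {d : ℕ}
    {e e' : Fin d → Derivation K B B} {u : K} (hu : u ≠ 0)
    (h : ∀ f, jacobian e' f = u • jacobian e f) :
    formMeasure absK μK e = absK u • formMeasure absK μK e' := by
  have hu' : (absK u : ℝ≥0∞) ≠ 0 := by simpa using hu
  have h' : ∀ f, jacobian e f = u⁻¹ • jacobian e' f := fun f => by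
    rw [h, smul_smul, inv_mul_cancel₀ hu, one_smul]
  refine le_antisymm (smul_formMeasure_le absK μK hu h) ?_
  have := smul_formMeasure_le absK μK (inv_ne_zero hu) h'
  rw [Measure.le_iff]
  intro s _
  have := this s
  rw [map_inv₀, ENNReal.coe_inv (by simpa using hu)] at this
  simp only [Measure.smul_apply] at this ⊢
  calc _ ≤ (absK u : ℝ≥0∞) * ((absK u : ℝ≥0∞)⁻¹ * formMeasure absK μK e s) :=
        mul_le_mul_right this _
    _ = _ := by
      rw [← mul_assoc, ENNReal.mul_inv_cancel hu' ENNReal.coe_ne_top, one_mul]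

end Scaling

/-! ### Independence of the Killing measure from the basis -/

section Killing

variable {K B : Type*} [Field K] [CommRing B] [HopfAlgebra K B]

theorem killingDet_eq_det_sq_mul {d : ℕ} {e e' : Fin d → lieAlg K B}
    (P : Matrix (Fin d) (Fin d) K) (h : ∀ i, e' i = ∑ m, P i m • e m) :
    killingDet K B e' = P.det ^ 2 * killingDet K B e := by
  have : (Matrix.of fun i j => killingForm K (lieAlg K B) (e' i) (e' j)) =
      P * (Matrix.of fun i j => killingForm K (lieAlg K B) (e i) (e j)) * P.transpose := by
    ext i j
    simp only [Matrix.of_apply, h, map_sum, map_smul, LinearMap.sum_apply, LinearMap.smul_apply,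
      smul_eq_mul, Matrix.mul_apply, Matrix.transpose_apply, Finset.sum_mul, Finset.mul_sum]
    refine Finset.sum_congr rfl fun _ _ => Finset.sum_congr rfl fun _ _ => by ring
  rw [killingDet, this, Matrix.det_mul, Matrix.det_mul, Matrix.det_transpose, killingDet]
  ring

/-- The square root turns the factor `(det P)²` of the Gram determinant into `|det P|`, which
cancels the factor of the form measure. -/
theorem killingMeasure_eq_of_basis [TopologicalSpace K] [MeasurableSpace K]
    (absK : K →*₀ ℝ≥0) (μK : Measure K) {d : ℕ} (e e' : Module.Basis (Fin d) K (lieAlg K B)) :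
    killingMeasure absK μK e = killingMeasure absK μK e' := by
  -- `toMatrix` stores the coordinates of `e' i` in a column; the transpose puts them in row `i`.
  set P : Matrix (Fin d) (Fin d) K := (e.toMatrix e').transpose with hP
  have h : ∀ i, e' i = ∑ m, P i m • e m := fun i => by
    simp [hP, Module.Basis.sum_toMatrix_smul_self]
  have hu : P.det ≠ 0 := by
    have := Module.Basis.toMatrix_mul_toMatrix_flip e e'
    apply_fun Matrix.det at this
    rw [Matrix.det_mul, Matrix.det_one] at this
    rw [hP, Matrix.det_transpose]
    exact left_ne_zero_of_mul_eq_one this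
  have hD : ∀ i, (e' i : Derivation K B B) = ∑ m, P i m • (e m : Derivation K B B) := fun i => by
    rw [h i]
    simp
  rw [killingMeasure, killingMeasure, killingDet_eq_det_sq_mul P h,
    formMeasure_eq_smul absK μK hu (jacobian_matrix_smul P hD), smul_smul, map_mul, map_pow,
    NNReal.sqrt_mul, NNReal.sqrt_sq, mul_comm]

end Killing

/-! ### Rescaling the factors of a product measure -/

section Product

variable {k A : Type*} [Field k] [NumberField k] [CommRing A] [Algebra k A]

/-- Once `S` contains the finite support of `cFin`, the partial products differ by the constant `∏ᶠ
v, cFin v`. It is nonzero and finite, so multiplication by it is an order automorphism of `ℝ≥0∞` and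
commutes with the liminf, whether or not the products converge. -/
theorem Box.volume_smul (E : Box k A)
    (μInf : ∀ v : InfinitePlace k, Measure (Points v.Completion (v.Completion ⊗[k] A)))
    (μFin : ∀ v : HeightOneSpectrum (𝓞 k),
      Measure (Points (v.adicCompletion k) (v.adicCompletion k ⊗[k] A)))
    (cInf : InfinitePlace k → ℝ≥0) (cFin : HeightOneSpectrum (𝓞 k) → ℝ≥0)
    (hfin : cFin.HasFiniteMulSupport) (hprod : (∏ v, cInf v) * ∏ᶠ v, cFin v = 1) :
    E.volume (fun v => cInf v • μInf v) (fun v => cFin v • μFin v) = E.volume μInf μFin := by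
  have hC : (∏ᶠ v, cFin v) ≠ 0 := right_ne_zero_of_mul_eq_one hprod
  have key : ∀ᶠ S : Finset (HeightOneSpectrum (𝓞 k)) in Filter.atTop,
      ∏ v ∈ S, (cFin v • μFin v) (E.fin v) =
        ((∏ᶠ v, cFin v : ℝ≥0) : ℝ≥0∞) * ∏ v ∈ S, μFin v (E.fin v) := by
    filter_upwards [Filter.eventually_ge_atTop hfin.toFinset] with S hS
    have : ∏ᶠ v, cFin v = ∏ v ∈ S, cFin v :=
      finprod_eq_prod_of_mulSupport_subset _ (by rwa [← Set.Finite.coe_toFinset hfin, Finset.coe_subset])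
    simp only [this, Measure.smul_apply, ENNReal.smul_def, smul_eq_mul, Finset.prod_mul_distrib,
      ENNReal.ofNNReal_finsetProd]
  rw [Box.volume, Box.volume, Filter.liminf_congr key]
  have hlim := (ENNReal.mulLeftOrderIso ((∏ᶠ v, cFin v : ℝ≥0) : ℝ≥0∞)
    (ENNReal.isUnit_iff.2 ⟨by simpa using hC, ENNReal.coe_ne_top⟩)).liminf_apply
    (f := (Filter.atTop : Filter (Finset (HeightOneSpectrum (𝓞 k)))))
    (u := fun S => ∏ v ∈ S, μFin v (E.fin v))
  simp only [ENNReal.mulLeftOrderIso_apply] at hlim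
  rw [← hlim]
  simp only [Measure.smul_apply, ENNReal.smul_def, smul_eq_mul, Finset.prod_mul_distrib]
  rw [mul_mul_mul_comm, ← ENNReal.ofNNReal_finsetProd, ← ENNReal.coe_mul, hprod, ENNReal.coe_one, one_mul]

theorem productMeasure_smul
    (μInf : ∀ v : InfinitePlace k, Measure (Points v.Completion (v.Completion ⊗[k] A)))
    (μFin : ∀ v : HeightOneSpectrum (𝓞 k),
      Measure (Points (v.adicCompletion k) (v.adicCompletion k ⊗[k] A)))
    (cInf : InfinitePlace k → ℝ≥0) (cFin : HeightOneSpectrum (𝓞 k) → ℝ≥0)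
    (hfin : cFin.HasFiniteMulSupport) (hprod : (∏ v, cInf v) * ∏ᶠ v, cFin v = 1) :
    productMeasure (fun v => cInf v • μInf v) (fun v => cFin v • μFin v) =
      productMeasure μInf μFin := by
  simp only [productMeasure, productOuterMeasure, Box.volume_smul _ μInf μFin cInf cFin hfin hprod]

end Product

/-! ### The product formula for the normalized absolute values -/

section AbsoluteValues

variable {k : Type*} [Field k]

/-- The normalized absolute value at an infinite place, as a homomorphism. -/
def absInfHom (v : InfinitePlace k) : v.Completion →*₀ ℝ≥0 where
  toFun := absInf v
  map_zero' := by simp [absInf, InfinitePlace.mult_ne_zero]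
  map_one' := by simp [absInf]
  map_mul' x y := by simp [absInf, mul_pow]

theorem coe_absInf_algebraMap (v : InfinitePlace k) (x : k) :
    (absInf v (algebraMap k v.Completion x) : ℝ) = v x ^ v.mult := by
  rw [absInf, NNReal.coe_pow, coe_nnnorm]
  congr 1
  exact InfinitePlace.Completion.norm_coe v _

variable [NumberField k]

/-- The normalized absolute value at a finite place, as a homomorphism. -/
def absFinHom (v : HeightOneSpectrum (𝓞 k)) : v.adicCompletion k →*₀ ℝ≥0 where
  toFun := absFin v
  map_zero' := by simp [absFin]
  map_one' := by simp [absFin]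
  map_mul' x y := by simp [absFin]

theorem coe_absFin_algebraMap (v : HeightOneSpectrum (𝓞 k)) (x : k) :
    (absFin v (algebraMap k (v.adicCompletion k) x) : ℝ) = FinitePlace.mk v x := by
  rw [FinitePlace.mk_apply, FinitePlace.norm_def]
  rfl

theorem hasFiniteMulSupport_absFin {x : k} (hx : x ≠ 0) :
    (fun v : HeightOneSpectrum (𝓞 k) =>
      absFin v (algebraMap k (v.adicCompletion k) x)).HasFiniteMulSupport := by
  have h := FinitePlace.hasFiniteMulSupport hx
  have h2 : (fun v : HeightOneSpectrum (𝓞 k) => FinitePlace.mk v x).HasFiniteMulSupport :=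
    Set.Finite.preimage FinitePlace.equivHeightOneSpectrum.symm.injective.injOn h
  refine h2.subset fun v hv => ?_
  simp only [Function.mem_mulSupport, ← coe_absFin_algebraMap] at hv ⊢
  exact_mod_cast hv

theorem prod_absInf_mul_finprod_absFin {x : k} (hx : x ≠ 0) :
    (∏ v : InfinitePlace k, absInf v (algebraMap k v.Completion x)) *
      ∏ᶠ v : HeightOneSpectrum (𝓞 k), absFin v (algebraMap k (v.adicCompletion k) x) = 1 := by
  have h := prod_abs_eq_one hx
  rw [← finprod_comp_equiv FinitePlace.equivHeightOneSpectrum.symm] at h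
  apply NNReal.coe_injective
  rw [NNReal.coe_mul, NNReal.coe_prod, NNReal.coe_one, ← h]
  congr 1
  · exact Finset.prod_congr rfl fun v _ => coe_absInf_algebraMap v x
  · refine (NNReal.toRealHom.toMonoidHom.map_finprod (hasFiniteMulSupport_absFin hx)).trans ?_
    exact finprod_congr fun v => coe_absFin_algebraMap v x

end AbsoluteValues

/-! ### Invariant derivations as right convolutions -/

section Convolution

open WithConv

variable {K B : Type*} [Field K] [CommRing B] [HopfAlgebra K B]

/-- Right convolution with a functional, `b ↦ ∑ b₁ φ(b₂)`. -/
def convRight (φ : WithConv (B →ₗ[K] K)) : B →ₗ[K] B :=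
  (TensorProduct.rid K B).toLinearMap ∘ₗ φ.ofConv.lTensor B ∘ₗ Coalgebra.comul

/-- Left convolution with a functional, `b ↦ ∑ φ(b₁) b₂`. -/
def convLeft (φ : WithConv (B →ₗ[K] K)) : B →ₗ[K] B :=
  (TensorProduct.lid K B).toLinearMap ∘ₗ φ.ofConv.rTensor B ∘ₗ Coalgebra.comul

theorem apply_convRight (φ ψ : WithConv (B →ₗ[K] K)) (b : B) :
    ψ (convRight φ b) = (ψ * φ) b := by
  rw [LinearMap.convMul_apply, convRight, LinearMap.comp_apply, LinearMap.comp_apply]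
  generalize Coalgebra.comul (R := K) b = t
  induction t with
  | zero => simp
  | add x y hx hy => simp only [map_add, hx, hy]
  | tmul x y => simp [mul_comm]

theorem apply_convLeft (φ ψ : WithConv (B →ₗ[K] K)) (b : B) :
    ψ (convLeft φ b) = (φ * ψ) b := by
  rw [LinearMap.convMul_apply, convLeft, LinearMap.comp_apply, LinearMap.comp_apply]
  generalize Coalgebra.comul (R := K) b = t
  induction t with
  | zero => simp
  | add x y hx hy => simp only [map_add, hx, hy]
  | tmul x y => simp

theorem eq_of_forall_conv_apply_eq {x y : B} (h : ∀ φ : WithConv (B →ₗ[K] K), φ x = φ y) :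
    x = y := by
  rw [← sub_eq_zero]
  refine (Module.forall_dual_apply_eq_zero_iff K _).1 fun f => ?_
  rw [map_sub, sub_eq_zero]
  exact h (toConv f)

/-- The point derivation at the identity given by a vector field. -/
def tangent (D : Derivation K B B) : WithConv (B →ₗ[K] K) :=
  toConv (Coalgebra.counit ∘ₗ (D : B →ₗ[K] B))

theorem tangent_apply (D : Derivation K B B) (b : B) :
    tangent D b = Coalgebra.counit (R := K) (D b) := rfl

/-- Invariance moves `D` from the second tensor factor in front of the comultiplication, leaving
convolution with the counit, which is the unit. -/
theorem conv_mul_tangent {D : Derivation K B B} (hD : D ∈ lieAlg K B)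
    (φ : WithConv (B →ₗ[K] K)) (b : B) : (φ * tangent D) b = φ (D b) := by
  have h : (φ * tangent D) b = (φ * 1) (D b) := by
    rw [LinearMap.convMul_apply, LinearMap.convMul_apply, hD b]
    generalize Coalgebra.comul (R := K) b = t
    induction t with
    | zero => simp
    | add x y hx hy => simp only [map_add, hx, hy]
    | tmul x y => simp [tangent]
  rw [h, mul_one]

/-- Functionals separate points, so the hypothesis says that `D` is `b ↦ ∑ b₁ φ(b₂)` with `φ =
tangent D`. Coassociativity makes every such operator left invariant. -/
theorem mem_lieAlg_of_forall_conv {D : Derivation K B B}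
    (h : ∀ (φ : WithConv (B →ₗ[K] K)) (b : B), φ (D b) = (φ * tangent D) b) :
    D ∈ lieAlg K B := by
  have hR : ∀ b, D b = convRight (tangent D) b := fun b =>
    eq_of_forall_conv_apply_eq fun φ => by rw [h, apply_convRight]
  have hR' : (D : B →ₗ[K] B) = convRight (tangent D) := LinearMap.ext hR
  intro b
  rw [hR', hR b]
  generalize tangent D = φ
  have h1 : ∀ t : B ⊗[K] B, Coalgebra.comul (R := K)
      (TensorProduct.rid K B (φ.ofConv.lTensor B t)) =
      (TensorProduct.rid K B).toLinearMap.lTensor B ((φ.ofConv.lTensor B).lTensor B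
        (TensorProduct.assoc K B B B (Coalgebra.comul.rTensor B t))) := by
    intro t
    induction t with
    | zero => simp
    | add x y hx hy => simp only [map_add, hx, hy]
    | tmul x y =>
      simp only [LinearMap.lTensor_tmul, TensorProduct.rid_tmul, map_smul, LinearMap.rTensor_tmul]
      generalize Coalgebra.comul (R := K) x = s
      induction s with
      | zero => simp
      | add x y hx hy => simp only [smul_add, hx, hy, TensorProduct.add_tmul, map_add]
      | tmul u v => simp
  rw [convRight, LinearMap.lTensor_comp, LinearMap.lTensor_comp]
  simp only [LinearMap.comp_apply, LinearEquiv.coe_coe]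
  rw [h1, Coalgebra.coassoc_apply]

theorem lieAlg_ext {D E : Derivation K B B} (hD : D ∈ lieAlg K B) (hE : E ∈ lieAlg K B)
    (h : tangent D = tangent E) : D = E :=
  Derivation.ext fun b => eq_of_forall_conv_apply_eq fun φ => by
    rw [← conv_mul_tangent hD, ← conv_mul_tangent hE, h]

end Convolution

/-! ### Extension of scalars for invariant derivations -/

section BaseChange

open WithConv

variable {k A : Type*} (L : Type*) [Field k] [CommRing A] [HopfAlgebra k A] [Field L] [Algebra k L]

@[simp]
theorem baseChangeDerivation_tmul (D : Derivation k A A) (l : L) (a : A) :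
    baseChangeDerivation L D (l ⊗ₜ a) = l ⊗ₜ D a := rfl

theorem derivation_ext_one_tmul {D E : Derivation L (L ⊗[k] A) (L ⊗[k] A)}
    (h : ∀ a : A, D (1 ⊗ₜ a) = E (1 ⊗ₜ a)) : D = E := by
  refine Derivation.ext fun x => ?_
  induction x with
  | zero => simp
  | add x y hx hy => simp only [map_add, hx, hy]
  | tmul l a =>
    rw [← mul_one l, ← smul_eq_mul, ← TensorProduct.smul_tmul', D.map_smul, E.map_smul, h]

/-- Restriction of a functional along `A → L ⊗ A`. -/
def restrictFunctional (φ : L ⊗[k] A →ₗ[L] L) : A →ₗ[k] L :=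
  φ.restrictScalars k ∘ₗ TensorProduct.mk k L A 1

theorem conv_mul_one_tmul (φ ψ : WithConv (L ⊗[k] A →ₗ[L] L)) (a : A) :
    (φ * ψ) (1 ⊗ₜ a) = LinearMap.mul' k L (TensorProduct.map (restrictFunctional L φ.ofConv)
      (restrictFunctional L ψ.ofConv) (Coalgebra.comul (R := k) a)) := by
  rw [LinearMap.convMul_apply, TensorProduct.comul_tmul]
  generalize Coalgebra.comul (R := k) a = t
  induction t with
  | zero => simp
  | add x y hx hy => simp only [TensorProduct.tmul_add, map_add, hx, hy]
  | tmul x y => simp [restrictFunctional]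

theorem baseChangeDerivation_mem {D : Derivation k A A} (hD : D ∈ lieAlg k A) :
    baseChangeDerivation L D ∈ lieAlg L (L ⊗[k] A) := by
  intro x
  induction x with
  | zero => simp
  | add x y hx hy => simp only [map_add, hx, hy]
  | tmul l a =>
    rw [baseChangeDerivation_tmul, TensorProduct.comul_tmul, TensorProduct.comul_tmul, hD a]
    generalize Coalgebra.comul (R := k) a = t
    induction t with
    | zero => simp
    | add x y hx hy => simp only [map_add, TensorProduct.tmul_add, hx, hy]
    | tmul x y => simp

end BaseChange

/-! ### Bases and the Killing form under extension of scalars -/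

section BaseChangeBasis

open WithConv

variable {k A L : Type*} [Field k] [CommRing A] [HopfAlgebra k A] [Field L] [Algebra k L]

theorem derivation_sum_apply {ι R M : Type*} [CommRing R] [CommRing M] [Algebra R M]
    (s : Finset ι) (D : ι → Derivation R M M) (x : M) :
    (∑ i ∈ s, D i) x = ∑ i ∈ s, D i x := by
  classical
  induction s using Finset.induction_on with
  | empty => simp
  | insert a s ha ih =>
    rw [Finset.sum_insert ha, Finset.sum_insert ha, Derivation.add_apply, ih]

theorem coe_sum_smul {ι K B : Type*} [Field K] [CommRing B] [HopfAlgebra K B] (s : Finset ι)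
    (c : ι → K) (x : ι → lieAlg K B) :
    ((∑ i ∈ s, c i • x i : lieAlg K B) : Derivation K B B) =
      ∑ i ∈ s, c i • (x i : Derivation K B B) :=
  map_sum (lieAlg K B).toSubmodule.subtype _ _

/-- The map `L ⊗ A → A` induced by a functional on `L`. -/
def contract (f : L →ₗ[k] k) : L ⊗[k] A →ₗ[k] A :=
  (TensorProduct.lid k A).toLinearMap ∘ₗ f.rTensor A

@[simp]
theorem contract_tmul (f : L →ₗ[k] k) (l : L) (a : A) : contract f (l ⊗ₜ[k] a) = f l • a := by
  simp [contract]

theorem contract_mul (f : L →ₗ[k] k) (a : A) (t : L ⊗[k] A) :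
    contract f ((1 ⊗ₜ a) * t) = a * contract f t := by
  induction t with
  | zero => simp
  | add x y hx hy => simp only [mul_add, map_add, hx, hy]
  | tmul l c => simp

/-- A coefficient, with respect to `L`, of a derivation of `L ⊗ A`. -/
def coeffDerivation (f : L →ₗ[k] k) (D : Derivation L (L ⊗[k] A) (L ⊗[k] A)) :
    Derivation k A A :=
  Derivation.mk' (contract f ∘ₗ (D : L ⊗[k] A →ₗ[L] L ⊗[k] A).restrictScalars k ∘ₗ
    TensorProduct.mk k L A 1) fun a c => by
      have : (1 : L) ⊗ₜ[k] (a * c) = (1 ⊗ₜ a) * (1 ⊗ₜ c) := by simp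
      change contract f (D (1 ⊗ₜ (a * c))) =
        a • contract f (D (1 ⊗ₜ c)) + c • contract f (D (1 ⊗ₜ a))
      rw [this, D.leibniz, map_add, smul_eq_mul, smul_eq_mul, contract_mul, contract_mul]
      rfl

theorem coeffDerivation_apply (f : L →ₗ[k] k) (D : Derivation L (L ⊗[k] A) (L ⊗[k] A)) (a : A) :
    coeffDerivation f D a = contract f (D (1 ⊗ₜ a)) := rfl

theorem apply_baseChange_functional (f : L →ₗ[k] k) (φ : A →ₗ[k] k) (t : L ⊗[k] A) :
    f (TensorProduct.AlgebraTensorModule.rid k L L (φ.baseChange L t)) = φ (contract f t) := by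
  induction t with
  | zero => simp
  | add x y hx hy => simp only [map_add, hx, hy]
  | tmul l c => simp [mul_comm]

theorem counit_contract (f : L →ₗ[k] k) (t : L ⊗[k] A) :
    Coalgebra.counit (R := k) (contract f t) = f (Coalgebra.counit (R := L) t) := by
  induction t with
  | zero => simp
  | add x y hx hy => simp only [map_add, hx, hy]
  | tmul l c => simp [mul_comm]

/-- A functional `φ` on `A` is extended `L`-linearly, the invariance of `D` is used over `L`, and
`f` is applied at the end. The extension takes values in `k` on `1 ⊗ A`, so these values pass
through the `k`-linear `f`. -/
theorem coeffDerivation_mem (f : L →ₗ[k] k) {D : Derivation L (L ⊗[k] A) (L ⊗[k] A)}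
    (hD : D ∈ lieAlg L (L ⊗[k] A)) : coeffDerivation f D ∈ lieAlg k A := by
  refine mem_lieAlg_of_forall_conv fun φ a => ?_
  set φL : WithConv (L ⊗[k] A →ₗ[L] L) :=
    toConv ((TensorProduct.AlgebraTensorModule.rid k L L).toLinearMap ∘ₗ φ.ofConv.baseChange L)
  have h1 : φ (coeffDerivation f D a) = f (φL (D (1 ⊗ₜ a))) :=
    (apply_baseChange_functional f φ.ofConv _).symm
  rw [h1, ← conv_mul_tangent hD, conv_mul_one_tmul, LinearMap.convMul_apply]
  generalize Coalgebra.comul (R := k) a = t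
  induction t with
  | zero => simp
  | add x y hx hy => simp only [map_add, hx, hy]
  | tmul x y =>
    have h2 : restrictFunctional L φL.ofConv x = algebraMap k L (φ x) := by
      simp [restrictFunctional, φL, Algebra.algebraMap_eq_smul_one]
    simp only [TensorProduct.map_tmul, LinearMap.mul'_apply, h2, ← Algebra.smul_def, map_smul,
      smul_eq_mul]
    congr 1
    exact (counit_contract f _).symm

theorem baseChangeDerivation_sum {d : ℕ} (c : Fin d → k) (D : Fin d → Derivation k A A) :
    baseChangeDerivation L (∑ i, c i • D i) =
      ∑ i, algebraMap k L (c i) • baseChangeDerivation L (D i) := by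
  refine derivation_ext_one_tmul L fun a => ?_
  simp [derivation_sum_apply, TensorProduct.tmul_sum]

/-- The coefficients of `D (1 ⊗ a)` in a `k`-basis of `L` are invariant derivations of `A`. The
field `L` may have infinite degree, but a derivation is determined by its values on finitely many
generators of `A`, so almost all coefficients vanish. -/
theorem exists_eq_sum_baseChangeDerivation [Algebra.FiniteType k A]
    {D : Derivation L (L ⊗[k] A) (L ⊗[k] A)} (hD : D ∈ lieAlg L (L ⊗[k] A)) :
    ∃ (s : Finset (Module.Basis.ofVectorSpaceIndex k L))
      (l : Module.Basis.ofVectorSpaceIndex k L → L)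
      (E : Module.Basis.ofVectorSpaceIndex k L → Derivation k A A),
      (∀ i, E i ∈ lieAlg k A) ∧ D = ∑ i ∈ s, l i • baseChangeDerivation L (E i) := by
  classical
  obtain ⟨S, hS⟩ := (inferInstance : Algebra.FiniteType k A).out
  let β := Module.Basis.ofVectorSpace k L
  let e := TensorProduct.equivFinsuppOfBasisLeft (N := A) β
  have he : ∀ t j, e t j = contract (β.coord j) t := fun t j => by
    induction t with
    | zero => simp
    | add x y hx hy => simp only [map_add, Finsupp.add_apply, hx, hy]
    | tmul l c => simp [e]
  let F := S.biUnion fun x => (e (D (1 ⊗ₜ x))).support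
  refine ⟨F, β, fun j => coeffDerivation (β.coord j) D, fun j => coeffDerivation_mem _ hD, ?_⟩
  have hz : ∀ j ∉ F, coeffDerivation (β.coord j) D = 0 := fun j hj => by
    refine Derivation.ext_of_adjoin_eq_top _ hS fun x hx => ?_
    rw [coeffDerivation_apply, ← he]
    by_contra h
    exact hj (Finset.mem_biUnion.2 ⟨x, hx, Finsupp.mem_support_iff.2 h⟩)
  refine derivation_ext_one_tmul L fun a => ?_
  have h1 : D (1 ⊗ₜ a) = (e (D (1 ⊗ₜ a))).sum fun i n => β i ⊗ₜ n := by
    conv_lhs => rw [← e.symm_apply_apply (D (1 ⊗ₜ a))]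
    exact TensorProduct.equivFinsuppOfBasisLeft_symm_apply _ _
  rw [h1, Finsupp.sum_of_support_subset (s := F) _ _ _ (by simp), derivation_sum_apply]
  · refine Finset.sum_congr rfl fun j _ => ?_
    rw [he, ← coeffDerivation_apply, Derivation.smul_apply, baseChangeDerivation_tmul,
      TensorProduct.smul_tmul', smul_eq_mul, mul_one]
  · intro j hj
    by_contra h
    refine Finsupp.mem_support_iff.1 hj ?_
    rw [he, ← coeffDerivation_apply, hz j h, Derivation.zero_apply]

variable {d : ℕ}

theorem linearIndependent_baseChange (b : Module.Basis (Fin d) k (lieAlg k A)) :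
    LinearIndependent L fun i => (⟨baseChangeDerivation L (b i), baseChangeDerivation_mem L (b i).2⟩ :
      lieAlg L (L ⊗[k] A)) := by
  rw [Fintype.linearIndependent_iff]
  intro l hl i
  have h0 : ∀ a : A, ∑ i, l i ⊗ₜ[k] (b i : Derivation k A A) a = 0 := fun a => by
    have := congrArg (fun D : lieAlg L (L ⊗[k] A) =>
      (D : Derivation L (L ⊗[k] A) (L ⊗[k] A)) (1 ⊗ₜ[k] a)) hl
    simpa [coe_sum_smul, derivation_sum_apply, TensorProduct.smul_tmul'] using this
  -- Each functional `f` on `L` carries the relation to one over `k`, so `f (l i) = 0` for all `f`.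
  refine (Module.forall_dual_apply_eq_zero_iff k _).1 fun f => ?_
  refine Fintype.linearIndependent_iff.1 b.linearIndependent (fun i => f (l i)) ?_ i
  refine Subtype.ext (Derivation.ext fun a => ?_)
  have := congrArg (contract f) (h0 a)
  simpa [coe_sum_smul, derivation_sum_apply] using this

theorem top_le_span_baseChange [Algebra.FiniteType k A]
    (b : Module.Basis (Fin d) k (lieAlg k A)) :
    ⊤ ≤ Submodule.span L (Set.range fun i =>
      (⟨baseChangeDerivation L (b i), baseChangeDerivation_mem L (b i).2⟩ :
        lieAlg L (L ⊗[k] A))) := by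
  rintro ⟨D, hD⟩ -
  obtain ⟨s, l, E, hE, rfl⟩ := exists_eq_sum_baseChangeDerivation hD
  have : (⟨_, hD⟩ : lieAlg L (L ⊗[k] A)) = ∑ i ∈ s, l i •
      ⟨baseChangeDerivation L (E i), baseChangeDerivation_mem L (hE i)⟩ := by
    ext1
    rw [coe_sum_smul]
  rw [this]
  refine Submodule.sum_mem _ fun i _ => Submodule.smul_mem _ _ ?_
  have h2 : E i = ∑ j, b.repr ⟨E i, hE i⟩ j • (b j : Derivation k A A) := by
    conv_lhs => rw [show E i = ((⟨E i, hE i⟩ : lieAlg k A) : Derivation k A A) from rfl,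
      ← b.sum_repr ⟨E i, hE i⟩, coe_sum_smul]
  have h3 : (⟨baseChangeDerivation L (E i), baseChangeDerivation_mem L (hE i)⟩ :
      lieAlg L (L ⊗[k] A)) = ∑ j, algebraMap k L (b.repr ⟨E i, hE i⟩ j) •
        ⟨baseChangeDerivation L (b j), baseChangeDerivation_mem L (b j).2⟩ := by
    ext1
    rw [coe_sum_smul, ← baseChangeDerivation_sum, ← h2]
  rw [h3]
  exact Submodule.sum_mem _ fun j _ => Submodule.smul_mem _ _ (Submodule.subset_span ⟨j, rfl⟩)

variable (L)

/-- The basis of `Lie(G_L)` obtained from a basis of `Lie(G)`. -/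
def baseChangeBasis [Algebra.FiniteType k A] (b : Module.Basis (Fin d) k (lieAlg k A)) :
    Module.Basis (Fin d) L (lieAlg L (L ⊗[k] A)) :=
  .mk (linearIndependent_baseChange b) (top_le_span_baseChange b)

variable [Algebra.FiniteType k A] (b : Module.Basis (Fin d) k (lieAlg k A))

@[simp]
theorem coe_baseChangeBasis (i : Fin d) :
    (baseChangeBasis L b i : Derivation L (L ⊗[k] A) (L ⊗[k] A)) =
      baseChangeDerivation L (b i : Derivation k A A) := by
  simp [baseChangeBasis]

/-- The structure constants come from `k`; hence so do the matrices of `ad` and their traces. -/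
theorem baseChangeBasis_lie (i j : Fin d) :
    ⁅baseChangeBasis L b i, baseChangeBasis L b j⁆ =
      ∑ m, algebraMap k L (b.repr ⁅b i, b j⁆ m) • baseChangeBasis L b m := by
  have h : ((⁅b i, b j⁆ : lieAlg k A) : Derivation k A A) =
      ∑ m, b.repr ⁅b i, b j⁆ m • (b m : Derivation k A A) := by
    conv_lhs => rw [← b.sum_repr ⁅b i, b j⁆, coe_sum_smul]
  ext1
  simp only [coe_sum_smul, coe_baseChangeBasis,
    LieSubalgebra.coe_bracket]
  rw [← baseChangeDerivation_sum, ← h]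
  refine derivation_ext_one_tmul L fun a => ?_
  simp [Derivation.commutator_apply, TensorProduct.tmul_sub]

theorem toMatrix_ad_baseChangeBasis (i : Fin d) :
    LinearMap.toMatrix (baseChangeBasis L b) (baseChangeBasis L b)
        (LieAlgebra.ad L _ (baseChangeBasis L b i)) =
      (LinearMap.toMatrix b b (LieAlgebra.ad k _ (b i))).map (algebraMap k L) := by
  ext m j
  rw [LinearMap.toMatrix_apply, LieAlgebra.ad_apply, baseChangeBasis_lie,
    Module.Basis.repr_sum_self, Matrix.map_apply, LinearMap.toMatrix_apply, LieAlgebra.ad_apply]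

theorem killingForm_eq_trace_toMatrix {K 𝔤 : Type*} [Field K] [LieRing 𝔤] [LieAlgebra K 𝔤]
    (b : Module.Basis (Fin d) K 𝔤) (x y : 𝔤) :
    killingForm K 𝔤 x y = Matrix.trace (LinearMap.toMatrix b b (LieAlgebra.ad K 𝔤 x) *
      LinearMap.toMatrix b b (LieAlgebra.ad K 𝔤 y)) := by
  rw [killingForm_apply_apply, LinearMap.trace_eq_matrix_trace K b, LinearMap.toMatrix_comp b b b]

theorem killingForm_baseChangeBasis (i j : Fin d) :
    killingForm L (lieAlg L (L ⊗[k] A)) (baseChangeBasis L b i) (baseChangeBasis L b j) =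
      algebraMap k L (killingForm k (lieAlg k A) (b i) (b j)) := by
  rw [killingForm_eq_trace_toMatrix (baseChangeBasis L b), killingForm_eq_trace_toMatrix b,
    toMatrix_ad_baseChangeBasis, toMatrix_ad_baseChangeBasis, ← Matrix.map_mul]
  exact (AddMonoidHom.map_trace (algebraMap k L).toAddMonoidHom _).symm

theorem killingDet_baseChangeBasis :
    killingDet L (L ⊗[k] A) (baseChangeBasis L b) = algebraMap k L (killingDet k A b) := by
  rw [killingDet, killingDet, RingHom.map_det]
  congr 1
  ext i j
  exact killingForm_baseChangeBasis L b i j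

end BaseChangeBasis

/-! ### Identity components when only translations are continuous -/

section Topology

/-- In a group with continuous translations, every closed normal subgroup contains a closed normal
connected subgroup which contains all its preconnected subsets through the identity. -/
theorem exists_identityComponent {G : Type*} [Group G] [TopologicalSpace G]
    (hl : ∀ g : G, Continuous fun x => g * x) (hr : ∀ g : G, Continuous fun x => x * g)
    (Z : Subgroup G) (hZn : Z.Normal) (hZ : IsClosed (Z : Set G)) :
    ∃ N : Subgroup G, N ≤ Z ∧ IsClosed (N : Set G) ∧ IsConnected (N : Set G) ∧ N.Normal ∧
      ∀ S : Set G, IsPreconnected S → 1 ∈ S → S ⊆ Z → S ⊆ N := by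
  set C := connectedComponentIn (Z : Set G) 1 with hC
  have h1 : (1 : G) ∈ C := mem_connectedComponentIn Z.one_mem
  have hCp : IsPreconnected C := isPreconnected_connectedComponentIn
  have hCZ : C ⊆ Z := connectedComponentIn_subset _ _
  have hmax : ∀ S : Set G, IsPreconnected S → 1 ∈ S → S ⊆ Z → S ⊆ C :=
    fun S hS h1S hSZ => hS.subset_connectedComponentIn h1S hSZ
  -- The translate `c⁻¹C` is preconnected and contains `c⁻¹c = 1`, so it lies in `C`. Continuity of
  -- inversion or of multiplication in two variables, which the Zariski topology does not offer, is
  -- avoided.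
  have hinv : ∀ c ∈ C, ∀ x ∈ C, c⁻¹ * x ∈ C := fun c hc x hx =>
    hmax ((fun x => c⁻¹ * x) '' C) (hCp.image _ (hl _).continuousOn) ⟨c, hc, by simp⟩
      (by rintro _ ⟨y, hy, rfl⟩; exact Z.mul_mem (Z.inv_mem (hCZ hc)) (hCZ hy)) ⟨x, hx, rfl⟩
  have hinv' : ∀ c ∈ C, c⁻¹ ∈ C := fun c hc => by simpa using hinv c hc 1 h1
  let N : Subgroup G :=
    { carrier := C
      one_mem' := h1
      inv_mem' := fun {c} hc => hinv' c hc
      mul_mem' := fun {a b} ha hb => by simpa using hinv a⁻¹ (hinv' a ha) b hb }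
  refine ⟨N, hCZ, ?_, ⟨⟨1, h1⟩, hCp⟩, ⟨fun n hn g => ?_⟩, hmax⟩
  · refine isClosed_of_closure_subset ?_
    exact hmax _ hCp.closure (subset_closure h1) (closure_minimal hCZ hZ)
  · refine hmax ((fun x => x * g⁻¹) '' ((fun x => g * x) '' C))
      ((hCp.image _ (hl _).continuousOn).image _ (hr _).continuousOn) ?_ ?_ ?_
    · exact ⟨g, ⟨1, h1, by simp⟩, by simp⟩
    · rintro _ ⟨_, ⟨y, hy, rfl⟩, rfl⟩
      exact hZn.conj_mem y (hCZ hy) g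
    · exact ⟨g * n, ⟨n, hn, rfl⟩, rfl⟩

end Topology

/-! ### An abelian ideal stable under all automorphisms -/

section LieAutomorphisms

open LieAlgebra

variable {K 𝔤 : Type*} [Field K] [LieRing 𝔤] [LieAlgebra K 𝔤]

theorem apply_mem_lieBracket_of_equiv (e : 𝔤 ≃ₗ⁅K⁆ 𝔤) {I J : LieIdeal K 𝔤}
    (hI : ∀ x ∈ I, e x ∈ I) (hJ : ∀ x ∈ J, e x ∈ J) : ∀ x ∈ ⁅I, J⁆, e x ∈ ⁅I, J⁆ := by
  intro x hx
  rw [← LieSubmodule.mem_toSubmodule, LieSubmodule.lieIdeal_oper_eq_linear_span'] at hx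
  induction hx using Submodule.span_induction with
  | mem x hx =>
    obtain ⟨a, ha, c, hc, rfl⟩ := hx
    rw [LieEquiv.map_lie]
    exact LieSubmodule.lie_mem_lie (hI a ha) (hJ c hc)
  | zero => simp
  | add x y _ _ hx hy => rw [map_add]; exact add_mem hx hy
  | smul c x _ hx => rw [map_smul]; exact (⁅I, J⁆).smul_mem c hx

/-- The image of the radical under `e` is an ideal which `e.symm` embeds in the radical, so it is
solvable and contained in the radical. -/
theorem apply_mem_radical_of_equiv [FiniteDimensional K 𝔤] (e : 𝔤 ≃ₗ⁅K⁆ 𝔤) :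
    ∀ x ∈ radical K 𝔤, e x ∈ radical K 𝔤 := by
  intro x hx
  let I : LieIdeal K 𝔤 := (radical K 𝔤).comap e.symm.toLieHom
  let f : I →ₗ⁅K⁆ radical K 𝔤 :=
    { toFun := fun y => ⟨e.symm y, y.2⟩
      map_add' := fun y z => Subtype.ext (map_add e.symm (y : 𝔤) z)
      map_smul' := fun c y => Subtype.ext (map_smul e.symm c (y : 𝔤))
      map_lie' := fun {y z} => Subtype.ext (LieEquiv.map_lie e.symm (y : 𝔤) z) }
  have hf : Function.Injective f := fun y z h =>
    Subtype.ext (e.symm.injective (congrArg Subtype.val h))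
  have hI : IsSolvable I := hf.lieAlgebra_isSolvable
  refine (LieIdeal.solvable_iff_le_radical K 𝔤 I).1 hI ?_
  change e.symm (e x) ∈ radical K 𝔤
  simpa using hx

/-- A Lie algebra with nontrivial radical has a nontrivial abelian ideal which is stable under all
automorphisms. -/
theorem exists_abelian_characteristic_ideal [FiniteDimensional K 𝔤] (h : radical K 𝔤 ≠ ⊥) :
    ∃ I : LieIdeal K 𝔤, I ≠ ⊥ ∧ (∀ x ∈ I, ∀ y ∈ I, ⁅x, y⁆ = 0) ∧
      ∀ e : 𝔤 ≃ₗ⁅K⁆ 𝔤, ∀ x ∈ I, e x ∈ I := by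
  -- This is the last nonzero term of the derived series of the radical, or `⊥` when the derived
  -- length is zero.
  refine ⟨derivedAbelianOfIdeal (radical K 𝔤),
    fun h0 => h ((abelian_of_solvable_ideal_eq_bot_iff _).1 h0), fun x hx y hy => ?_, fun e => ?_⟩
  · have := (abelian_derivedAbelianOfIdeal (radical K 𝔤)).trivial ⟨x, hx⟩ ⟨y, hy⟩
    exact congrArg Subtype.val this
  · have key : ∀ n, ∀ x ∈ derivedSeriesOfIdeal K 𝔤 n (radical K 𝔤),
        e x ∈ derivedSeriesOfIdeal K 𝔤 n (radical K 𝔤) := by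
      intro n
      induction n with
      | zero => exact apply_mem_radical_of_equiv e
      | succ n ih =>
        rw [derivedSeriesOfIdeal_succ]
        exact apply_mem_lieBracket_of_equiv e ih ih
    unfold derivedAbelianOfIdeal
    split
    · simp
    · exact key _

end LieAutomorphisms

/-! ### The Nullstellensatz and formal one-parameter groups -/

section Points

variable {K B : Type*} [Field K] [CommRing B] [Algebra K B]

/-- Nullstellensatz: a regular function not in the prime ideal `P` is nonzero at some point of the
zero locus of `P`. -/
theorem exists_point_of_notMem_prime [IsAlgClosed K] [Algebra.FiniteType K B] (P : Ideal B)
    [P.IsPrime] {f : B} (hf : f ∉ P) :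
    ∃ g : B →ₐ[K] K, (∀ x ∈ P, g x = 0) ∧ g f ≠ 0 := by
  have : IsJacobsonRing B := isJacobsonRing_of_finiteType (A := K)
  -- `P` is an intersection of maximal ideals, so one of them omits `f`; its residue field is finite
  -- over `K`, hence equal to `K`.
  have hP : P.jacobson = P := IsJacobsonRing.out inferInstance (Ideal.IsPrime.isRadical ‹_›)
  rw [← hP, Ideal.jacobson, Ideal.mem_sInf] at hf
  push Not at hf
  obtain ⟨m, ⟨hPm, hm⟩, hfm⟩ := hf
  let := Ideal.Quotient.field m
  have hfin : Module.Finite K (B ⧸ m) := finite_of_finite_type_of_isJacobsonRing K (B ⧸ m)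
  have hbij := IsAlgClosed.algebraMap_bijective_of_isIntegral (k := K) (K := B ⧸ m)
  let e := AlgEquiv.ofBijective (Algebra.ofId K (B ⧸ m)) hbij
  have he : ∀ x, e.symm (Ideal.Quotient.mk m x) = 0 ↔ x ∈ m := fun x => by
    rw [map_eq_zero_iff _ e.symm.injective, Ideal.Quotient.eq_zero_iff_mem]
  exact ⟨e.symm.toAlgHom.comp (Ideal.Quotient.mkₐ K m), fun x hx => (he x).2 (hPm hx),
    fun h => hfm ((he f).1 h)⟩

/-- Leibniz's rule for iterated derivations. -/
theorem derivation_iterate_mul (D : Derivation K B B) (n : ℕ) (a b : B) :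
    D^[n] (a * b) = ∑ p ∈ Finset.HasAntidiagonal.antidiagonal n, n.choose p.1 • (D^[p.1] a * D^[p.2] b) := by
  induction n with
  | zero => simp
  | succ n ih =>
    rw [Finset.sum_antidiagonal_choose_succ_nsmul (fun i j => D^[i] a * D^[j] b),
      Function.iterate_succ_apply', ih, map_sum, ← Finset.sum_add_distrib]
    refine Finset.sum_congr rfl fun p hp => ?_
    rw [map_nsmul, D.leibniz, Function.iterate_succ_apply', Function.iterate_succ_apply',
      Nat.choose_symm_of_eq_add (Finset.HasAntidiagonal.mem_antidiagonal.1 hp).symm, smul_eq_mul, smul_eq_mul,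
      smul_add, mul_comm (D^[p.2] b)]

/-- The ideal of the functions all of whose derivatives along `D` vanish at the point `ε`. -/
def orbitIdeal (D : Derivation K B B) (ε : B →ₐ[K] K) : Ideal B where
  carrier := {b | ∀ n, ε (D^[n] b) = 0}
  zero_mem' n := by
    have : D^[n] 0 = 0 := Function.iterate_fixed (map_zero D) n
    simp [this]
  add_mem' {a b} ha hb n := by
    have : D^[n] (a + b) = D^[n] a + D^[n] b := iterate_map_add D n a b
    rw [this, map_add, ha n, hb n, add_zero]
  smul_mem' c a ha n := by
    rw [smul_eq_mul, derivation_iterate_mul, map_sum]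
    refine Finset.sum_eq_zero fun p _ => ?_
    rw [map_nsmul, map_mul, ha, mul_zero, smul_zero]

theorem mem_orbitIdeal {D : Derivation K B B} {ε : B →ₐ[K] K} {b : B} :
    b ∈ orbitIdeal D ε ↔ ∀ n, ε (D^[n] b) = 0 := Iff.rfl

/-- In characteristic zero this is the kernel of the Taylor homomorphism `b ↦ ∑ ε(Dⁿ b) tⁿ / n!` to
the domain `K⟦t⟧`. The argument compares lowest terms directly. -/
instance orbitIdeal_isPrime [CharZero K] (D : Derivation K B B) (ε : B →ₐ[K] K) :
    (orbitIdeal D ε).IsPrime := by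
  classical
  refine ⟨fun h => ?_, fun {a b} hab => ?_⟩
  · have := (Ideal.eq_top_iff_one _).1 h 0
    simp at this
  · by_contra hcon
    push Not at hcon
    obtain ⟨ha, hb⟩ := hcon
    simp only [mem_orbitIdeal, not_forall] at ha hb
    have hi := Nat.find_spec ha
    have hj := Nat.find_spec hb
    have hi' : ∀ n < Nat.find ha, ε (D^[n] a) = 0 := fun n hn => not_not.1 (Nat.find_min ha hn)
    have hj' : ∀ n < Nat.find hb, ε (D^[n] b) = 0 := fun n hn => not_not.1 (Nat.find_min hb hn)
    generalize Nat.find ha = i at *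
    generalize Nat.find hb = j at *
    have h := hab (i + j)
    -- With `i` and `j` the orders of vanishing of `a` and `b`, only the term `(i, j)` of Leibniz's
    -- rule survives.
    rw [derivation_iterate_mul, map_sum, Finset.sum_eq_single (i, j)] at h
    · rw [map_nsmul, map_mul, nsmul_eq_mul] at h
      exact mul_ne_zero (Nat.cast_ne_zero.2 (Nat.choose_pos (Nat.le_add_right i j)).ne')
        (mul_ne_zero hi hj) h
    · rintro ⟨p, q⟩ hpq hne
      rw [Finset.HasAntidiagonal.mem_antidiagonal] at hpq
      rw [map_nsmul, map_mul]
      rcases lt_or_ge p i with hp | hp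
      · rw [hi' p hp, zero_mul, smul_zero]
      · have hq : q < j := by
          by_contra hq
          exact hne (Prod.ext (by simp at hpq ⊢; omega) (by simp at hpq ⊢; omega))
        rw [hj' q hq, mul_zero, smul_zero]
    · intro hn
      exact (hn (Finset.HasAntidiagonal.mem_antidiagonal.2 rfl)).elim

end Points

/-! ### From trivial radical of the group to trivial radical of the Lie algebra -/

section Semisimple

open WithConv

variable {K B : Type*} [Field K] [CommRing B] [HopfAlgebra K B]

section Functionals

/-- The evaluation functional of a point, as a homomorphism to the convolution algebra. -/
def evalHom (K B : Type*) [Field K] [CommRing B] [HopfAlgebra K B] :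
    WithConv (B →ₐ[K] K) →* WithConv (B →ₗ[K] K) where
  toFun g := toConv g.ofConv.toLinearMap
  map_one' := rfl
  map_mul' := AlgHom.toLinearMap_convMul

theorem evalHom_apply (g : WithConv (B →ₐ[K] K)) (b : B) : evalHom K B g b = g b := rfl

theorem evalHom_injective : Function.Injective (evalHom K B) := fun _ _ hgh =>
  ofConv_injective (AlgHom.ext fun b => congrArg (fun φ : WithConv (B →ₗ[K] K) => φ b) hgh)

theorem conv_ext {φ ψ : WithConv (B →ₗ[K] K)} (h : ∀ b, φ b = ψ b) : φ = ψ :=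
  ofConv_injective (LinearMap.ext h)

/-- This makes `orbitIdeal` at the counit the common kernel of the convolution powers of `tangent
D`. -/
theorem tangent_pow_apply {D : Derivation K B B} (hD : D ∈ lieAlg K B) (n : ℕ) (b : B) :
    (tangent D ^ n) b = Coalgebra.counit (R := K) (D^[n] b) := by
  induction n generalizing b with
  | zero => simp
  | succ n ih => rw [pow_succ, conv_mul_tangent hD, ih, Function.iterate_succ_apply]

theorem commute_tangent {D E : Derivation K B B} (hD : D ∈ lieAlg K B) (hE : E ∈ lieAlg K B)
    (h : ⁅D, E⁆ = 0) : Commute (tangent D) (tangent E) := by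
  refine conv_ext fun b => ?_
  rw [conv_mul_tangent hE, conv_mul_tangent hD, tangent_apply, tangent_apply]
  have := congrArg (fun F : Derivation K B B => F b) h
  simp only [Derivation.commutator_apply, Derivation.zero_apply, sub_eq_zero] at this
  rw [this]

/-- A point in the closure of the one-parameter group generated by `D` commutes with every
functional commuting with `D`. -/
theorem commute_evalHom_of_orbitIdeal {D : Derivation K B B} (hD : D ∈ lieAlg K B)
    {ψ : WithConv (B →ₗ[K] K)} (hψ : Commute ψ (tangent D)) {g : WithConv (B →ₐ[K] K)}
    (hg : ∀ b ∈ orbitIdeal D (Bialgebra.counitAlgHom K B), g b = 0) :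
    Commute (evalHom K B g) ψ := by
  refine conv_ext fun b => ?_
  -- A functional commutes with `ψ` exactly when it kills all these elements. The powers of `tangent
  -- D` do so, hence the elements lie in the ideal on which `g` vanishes.
  have hz : convRight ψ b - convLeft ψ b ∈ orbitIdeal D (Bialgebra.counitAlgHom K B) := by
    intro n
    have : Bialgebra.counitAlgHom K B (D^[n] (convRight ψ b - convLeft ψ b)) =
        (tangent D ^ n) (convRight ψ b - convLeft ψ b) := (tangent_pow_apply hD n _).symm
    rw [this, map_sub, apply_convRight, apply_convLeft, (hψ.pow_right n).eq, sub_self]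
  have h := hg _ hz
  rw [← evalHom_apply, map_sub, apply_convRight, apply_convLeft] at h
  exact sub_eq_zero.1 h

/-- The points of `G` commuting with a set of functionals. -/
def pointCentralizer (S : Set (WithConv (B →ₗ[K] K))) : Subgroup (WithConv (B →ₐ[K] K)) where
  carrier := {g | ∀ s ∈ S, Commute (evalHom K B g) s}
  one_mem' s _ := by
    rw [map_one]
    exact Commute.one_left s
  mul_mem' {g h} hg hh s hs := by
    rw [map_mul]
    exact (hg s hs).mul_left (hh s hs)
  inv_mem' {g} hg s hs := by
    have h1 : evalHom K B g⁻¹ * evalHom K B g = 1 := by rw [← map_mul, inv_mul_cancel, map_one]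
    have h2 : evalHom K B g * evalHom K B g⁻¹ = 1 := by rw [← map_mul, mul_inv_cancel, map_one]
    calc evalHom K B g⁻¹ * s = evalHom K B g⁻¹ * (s * evalHom K B g) * evalHom K B g⁻¹ := by
          rw [mul_assoc, mul_assoc, h2, mul_one]
      _ = s * evalHom K B g⁻¹ := by
          rw [← (hg s hs).eq, ← mul_assoc, h1, one_mul]

theorem pointCentralizer_normal {S : Set (WithConv (B →ₗ[K] K))}
    (hS : ∀ g, ∀ s ∈ S, evalHom K B g * s * evalHom K B g⁻¹ ∈ S) :
    (pointCentralizer S).Normal := by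
  refine ⟨fun n hn g s hs => ?_⟩
  have h := hn _ (hS g⁻¹ s hs)
  rw [inv_inv] at h
  have h1 : evalHom K B g⁻¹ * evalHom K B g = 1 := by rw [← map_mul, inv_mul_cancel, map_one]
  have h2 : evalHom K B g * evalHom K B g⁻¹ = 1 := by rw [← map_mul, mul_inv_cancel, map_one]
  rw [map_mul, map_mul]
  generalize evalHom K B g = x at *
  generalize evalHom K B g⁻¹ = y at *
  generalize evalHom K B n = z at *
  calc x * z * y * s = x * (z * (y * s * x)) * y := by
        simp only [mul_assoc, h2, mul_one]
    _ = s * (x * z * y) := by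
        rw [h.eq]
        simp only [← mul_assoc, h2, one_mul]

end Functionals

section Adjoint

/-- Right translation by a point on the coordinate ring. -/
def translation (g : WithConv (B →ₐ[K] K)) : B →ₐ[K] B :=
  (Algebra.TensorProduct.rid K K B).toAlgHom.comp
    ((Algebra.TensorProduct.map (AlgHom.id K B) g.ofConv).comp (Bialgebra.comulAlgHom K B))

theorem apply_translation (g : WithConv (B →ₐ[K] K)) (φ : WithConv (B →ₗ[K] K)) (b : B) :
    φ (translation g b) = (φ * evalHom K B g) b :=
  apply_convRight (evalHom K B g) φ b

theorem translation_mul (g h : WithConv (B →ₐ[K] K)) :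
    (translation g).comp (translation h) = translation (g * h) :=
  AlgHom.ext fun b => eq_of_forall_conv_apply_eq fun φ => by
    rw [AlgHom.comp_apply, apply_translation, apply_translation, apply_translation, map_mul,
      mul_assoc]

theorem translation_one : translation (1 : WithConv (B →ₐ[K] K)) = AlgHom.id K B :=
  AlgHom.ext fun b => eq_of_forall_conv_apply_eq fun φ => by
    rw [apply_translation, map_one, mul_one, AlgHom.id_apply]

theorem translation_translation_inv (g : WithConv (B →ₐ[K] K)) (b : B) :
    translation g (translation g⁻¹ b) = b := by
  rw [← AlgHom.comp_apply, translation_mul, mul_inv_cancel, translation_one, AlgHom.id_apply]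

theorem translation_inv_translation (g : WithConv (B →ₐ[K] K)) (b : B) :
    translation g⁻¹ (translation g b) = b := by
  simpa using translation_translation_inv g⁻¹ b

/-- The conjugate of a derivation by a right translation. -/
def conjDerivation (g : WithConv (B →ₐ[K] K)) (D : Derivation K B B) : Derivation K B B :=
  Derivation.mk' ((translation g).toLinearMap ∘ₗ (D : B →ₗ[K] B) ∘ₗ (translation g⁻¹).toLinearMap)
    fun a b => by
      simp [D.leibniz, translation_translation_inv]

theorem conjDerivation_apply (g : WithConv (B →ₐ[K] K)) (D : Derivation K B B) (b : B) :
    conjDerivation g D b = translation g (D (translation g⁻¹ b)) := rfl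

/-- Translations and `D` all act by right convolution, so conjugating the operators conjugates the
functionals. -/
theorem conv_conjDerivation (g : WithConv (B →ₐ[K] K)) {D : Derivation K B B}
    (hD : D ∈ lieAlg K B) (φ : WithConv (B →ₗ[K] K)) (b : B) :
    φ (conjDerivation g D b) = (φ * (evalHom K B g * tangent D * evalHom K B g⁻¹)) b := by
  rw [conjDerivation_apply, apply_translation, ← conv_mul_tangent hD, apply_translation]
  simp only [mul_assoc]

theorem tangent_conjDerivation (g : WithConv (B →ₐ[K] K)) {D : Derivation K B B}
    (hD : D ∈ lieAlg K B) :
    tangent (conjDerivation g D) = evalHom K B g * tangent D * evalHom K B g⁻¹ :=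
  conv_ext fun b => by
    have := conv_conjDerivation g hD 1 b
    rw [one_mul] at this
    rw [← this]
    rfl

theorem conjDerivation_mem (g : WithConv (B →ₐ[K] K)) {D : Derivation K B B}
    (hD : D ∈ lieAlg K B) : conjDerivation g D ∈ lieAlg K B :=
  mem_lieAlg_of_forall_conv fun φ b => by
    rw [tangent_conjDerivation g hD, conv_conjDerivation g hD]

/-- The adjoint action of a point on the Lie algebra. -/
def adjointEquiv (g : WithConv (B →ₐ[K] K)) : lieAlg K B ≃ₗ⁅K⁆ lieAlg K B where
  toFun D := ⟨conjDerivation g D, conjDerivation_mem g D.2⟩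
  invFun D := ⟨conjDerivation g⁻¹ D, conjDerivation_mem g⁻¹ D.2⟩
  map_add' D E := by
    refine Subtype.ext (Derivation.ext fun b => ?_)
    simp [conjDerivation_apply]
  map_smul' c D := by
    refine Subtype.ext (Derivation.ext fun b => ?_)
    simp [conjDerivation_apply]
  map_lie' {D E} := by
    refine Subtype.ext (Derivation.ext fun b => ?_)
    simp [conjDerivation_apply, Derivation.commutator_apply, translation_inv_translation]
  left_inv D := by
    refine Subtype.ext (Derivation.ext fun b => ?_)
    simp [conjDerivation_apply, translation_inv_translation]
  right_inv D := by
    refine Subtype.ext (Derivation.ext fun b => ?_)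
    simp [conjDerivation_apply, translation_translation_inv]

theorem tangent_adjointEquiv (g : WithConv (B →ₐ[K] K)) (D : lieAlg K B) :
    tangent (adjointEquiv g D : Derivation K B B) =
      evalHom K B g * tangent (D : Derivation K B B) * evalHom K B g⁻¹ :=
  tangent_conjDerivation g D.2

end Adjoint

section Zariski

theorem isClosed_zeroLocus (T : Set B) :
    letI := zariskiTopology K B
    IsClosed {g : WithConv (B →ₐ[K] K) | ∀ b ∈ T, g b = 0} := by
  let := zariskiTopology K B
  exact isClosed_induced_iff.2 ⟨_, PrimeSpectrum.isClosed_zeroLocus T, rfl⟩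

theorem exists_zeroLocus_of_isClosed {Z : Set (WithConv (B →ₐ[K] K))}
    (hZ : letI := zariskiTopology K B; IsClosed Z) :
    ∃ T : Set B, Z = {g : WithConv (B →ₐ[K] K) | ∀ b ∈ T, g b = 0} := by
  let := zariskiTopology K B
  obtain ⟨t, ht, rfl⟩ := isClosed_induced_iff.1 hZ
  obtain ⟨T, rfl⟩ := (PrimeSpectrum.isClosed_iff_zeroLocus _).1 ht
  exact ⟨T, rfl⟩

theorem continuous_mul_left_zariski (h : WithConv (B →ₐ[K] K)) :
    letI := zariskiTopology K B
    Continuous fun g : WithConv (B →ₐ[K] K) => h * g := by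
  let := zariskiTopology K B
  refine continuous_iff_isClosed.2 fun Z hZ => ?_
  obtain ⟨T, rfl⟩ := exists_zeroLocus_of_isClosed hZ
  convert isClosed_zeroLocus (K := K) (convLeft (evalHom K B h) '' T) using 1
  ext g
  simp [← evalHom_apply, apply_convLeft]

theorem continuous_mul_right_zariski (h : WithConv (B →ₐ[K] K)) :
    letI := zariskiTopology K B
    Continuous fun g : WithConv (B →ₐ[K] K) => g * h := by
  let := zariskiTopology K B
  refine continuous_iff_isClosed.2 fun Z hZ => ?_
  obtain ⟨T, rfl⟩ := exists_zeroLocus_of_isClosed hZ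
  convert isClosed_zeroLocus (K := K) (convRight (evalHom K B h) '' T) using 1
  ext g
  simp [← evalHom_apply, apply_convRight]

theorem isClosed_pointCentralizer (S : Set (WithConv (B →ₗ[K] K))) :
    letI := zariskiTopology K B
    IsClosed (pointCentralizer S : Set (WithConv (B →ₐ[K] K))) := by
  let := zariskiTopology K B
  convert isClosed_zeroLocus (K := K) {x : B | ∃ s ∈ S, ∃ b, x = convRight s b - convLeft s b}
    using 1
  ext g
  constructor
  · rintro hg _ ⟨s, hs, b, rfl⟩
    rw [← evalHom_apply, map_sub, apply_convRight, apply_convLeft, (hg s hs).eq, sub_self]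
  · intro hg s hs
    refine conv_ext fun b => ?_
    have := hg _ ⟨s, hs, b, rfl⟩
    rw [← evalHom_apply, map_sub, apply_convRight, apply_convLeft] at this
    exact sub_eq_zero.1 this

/-- The locus is irreducible: two open sets meeting it contain the nonvanishing loci of some `f, f'
∉ P`, and the Nullstellensatz gives a point of the locus where `f * f'` is nonzero. -/
theorem isPreconnected_zeroLocus [IsAlgClosed K] [Algebra.FiniteType K B] (P : Ideal B)
    [P.IsPrime] :
    letI := zariskiTopology K B
    IsPreconnected {g : WithConv (B →ₐ[K] K) | ∀ b ∈ P, g b = 0} := by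
  let := zariskiTopology K B
  refine IsPreirreducible.isPreconnected ?_
  have key : ∀ u : Set (WithConv (B →ₐ[K] K)), IsOpen u →
      ({g : WithConv (B →ₐ[K] K) | ∀ b ∈ P, g b = 0} ∩ u).Nonempty →
      ∃ f ∉ P, ∀ g : WithConv (B →ₐ[K] K), g f ≠ 0 → g ∈ u := by
    rintro u hu ⟨g, hg, hgu⟩
    obtain ⟨T, hT⟩ := exists_zeroLocus_of_isClosed hu.isClosed_compl
    have hgT : g ∉ uᶜ := fun h => h hgu
    rw [hT, Set.mem_ofPred_eq] at hgT
    push Not at hgT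
    obtain ⟨f, hfT, hf⟩ := hgT
    refine ⟨f, fun hfP => hf (hg f hfP), fun h hh => ?_⟩
    by_contra hu'
    rw [← Set.mem_compl_iff, hT] at hu'
    exact hh (hu' f hfT)
  intro u v hu hv hnu hnv
  obtain ⟨f, hfP, hf⟩ := key u hu hnu
  obtain ⟨f', hfP', hf'⟩ := key v hv hnv
  have hff : f * f' ∉ P := fun h => (Ideal.IsPrime.mem_or_mem ‹_› h).elim hfP hfP'
  obtain ⟨g, hgP, hg⟩ := exists_point_of_notMem_prime (K := K) P hff
  rw [map_mul] at hg
  exact ⟨toConv g, hgP, hf _ (left_ne_zero_of_mul hg), hf' _ (right_ne_zero_of_mul hg)⟩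

end Zariski

/-- If the only closed connected solvable normal subgroup of `G(K)` is trivial, then the Lie algebra
of `G` has trivial radical. -/
theorem radical_lieAlg_eq_bot [IsAlgClosed K] [CharZero K] [Algebra.FiniteType K B]
    [FiniteDimensional K (lieAlg K B)]
    (h : letI := zariskiTopology K B
      ∀ N : Subgroup (WithConv (B →ₐ[K] K)), IsClosed (N : Set (WithConv (B →ₐ[K] K))) →
        IsConnected (N : Set (WithConv (B →ₐ[K] K))) → N.Normal → Group.IsSolvable N → N = ⊥) :
    LieAlgebra.radical K (lieAlg K B) = ⊥ := by
  let := zariskiTopology K B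
  by_contra hrad
  obtain ⟨I, hI, hab, haut⟩ := exists_abelian_characteristic_ideal hrad
  set S : Set (WithConv (B →ₗ[K] K)) :=
    {s | ∃ D : lieAlg K B, D ∈ I ∧ tangent (D : Derivation K B B) = s}
  have hS : ∀ g, ∀ s ∈ S, evalHom K B g * s * evalHom K B g⁻¹ ∈ S := by
    rintro g _ ⟨D, hD, rfl⟩
    exact ⟨adjointEquiv g D, haut _ D hD, tangent_adjointEquiv g D⟩
  have hC := pointCentralizer_normal hS
  -- Commuting with `S` and with its centralizer defines the center of that centralizer, which makes
  -- the subgroup `N` below commutative.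
  set S' := S ∪ evalHom K B '' pointCentralizer S
  have hS' : ∀ g, ∀ s ∈ S', evalHom K B g * s * evalHom K B g⁻¹ ∈ S' := by
    rintro g _ (hs | ⟨c, hc, rfl⟩)
    · exact Or.inl (hS g _ hs)
    · exact Or.inr ⟨g * c * g⁻¹, hC.conj_mem c hc g, by simp only [map_mul]⟩
  obtain ⟨N, hNZ, hNc, hNconn, hNn, hmax⟩ := exists_identityComponent
    continuous_mul_left_zariski continuous_mul_right_zariski (pointCentralizer S')
    (pointCentralizer_normal hS') (isClosed_pointCentralizer S')
  have hcomm : ∀ x ∈ N, ∀ y ∈ N, x * y = y * x := fun x hx y hy => by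
    have hy' : y ∈ pointCentralizer S := fun s hs => hNZ hy s (Or.inl hs)
    refine evalHom_injective ?_
    rw [map_mul, map_mul]
    exact hNZ hx _ (Or.inr ⟨y, hy', rfl⟩)
  have hsolv : Group.IsSolvable N :=
    Group.isSolvable_of_comm fun x y => Subtype.ext (hcomm x x.2 y y.2)
  have hbot := h N hNc hNconn hNn hsolv
  obtain ⟨D, hDI, hD0⟩ : ∃ D ∈ I, D ≠ 0 := by
    by_contra hcon
    push Not at hcon
    exact hI ((LieSubmodule.eq_bot_iff I).2 hcon)
  have hne : ∃ f, tangent (D : Derivation K B B) f ≠ 0 := by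
    by_contra hcon
    push Not at hcon
    refine hD0 (Subtype.ext (lieAlg_ext D.2 (zero_mem _) (conv_ext fun b => ?_)))
    exact (hcon b).trans (map_zero (Coalgebra.counit (R := K) (A := B))).symm
  obtain ⟨f, hf⟩ := hne
  set ε := Bialgebra.counitAlgHom K B
  -- Subtracting the constant makes `f₀` vanish at the identity without changing its derivative
  -- along `D`. A point of the locus where `f₀` is nonzero is thus not the identity.
  set f₀ := f - algebraMap K B (ε f)
  have hf₀ : f₀ ∉ orbitIdeal (D : Derivation K B B) ε := fun hmem => by
    have := hmem 1
    simp only [Function.iterate_one, f₀, map_sub, Derivation.map_algebraMap,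
      sub_zero] at this
    exact hf this
  obtain ⟨g, hgP, hg⟩ := exists_point_of_notMem_prime (K := K) _ hf₀
  -- Points of the locus commute with whatever commutes with `D`: with `I`, which is abelian, and
  -- with the points centralizing `I`.
  have hsub := hmax {g : WithConv (B →ₐ[K] K) | ∀ b ∈ orbitIdeal (D : Derivation K B B) ε, g b = 0}
    (isPreconnected_zeroLocus _) (fun b hb => hb 0) (fun x hx s hs => by
      refine commute_evalHom_of_orbitIdeal D.2 ?_ hx
      rcases hs with ⟨E, hE, rfl⟩ | ⟨c, hc, rfl⟩
      · refine commute_tangent E.2 D.2 ?_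
        exact congrArg Subtype.val (hab E hE D hDI)
      · exact hc _ ⟨D, hDI, rfl⟩)
  have hgN : toConv g ∈ N := hsub hgP
  rw [hbot, Subgroup.mem_bot] at hgN
  have hgε : g f₀ = ε f₀ := congrArg (fun x : WithConv (B →ₐ[K] K) => x f₀) hgN
  refine hg (hgε.trans ?_)
  simp [f₀]

end Semisimple

/-! ### Nondegeneracy of the Killing form and comparison of the measures -/

theorem killingDet_ne_zero_of_isKilling {K B : Type*} [Field K] [CommRing B] [HopfAlgebra K B]
    {d : ℕ} (e : Module.Basis (Fin d) K (lieAlg K B)) [LieAlgebra.IsKilling K (lieAlg K B)] :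
    killingDet K B e ≠ 0 := by
  have : Module.Finite K (lieAlg K B) := .of_basis e
  have h : killingDet K B e = (LinearMap.BilinForm.toMatrix e (killingForm K (lieAlg K B))).det := by
    rw [killingDet]
    congr 1
    ext i j
    rw [LinearMap.BilinForm.toMatrix_apply, Matrix.of_apply]
  rw [h]
  exact (LinearMap.BilinForm.nondegenerate_iff_det_ne_zero (B := killingForm K (lieAlg K B)) e).1
    (LieAlgebra.IsKilling.killingForm_nondegenerate K (lieAlg K B))

/-- The Killing form of a semisimple group over a field of characteristic zero is nondegenerate. -/
theorem killingDet_ne_zero {k A : Type*} [Field k] [CharZero k] [CommRing A] [HopfAlgebra k A]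
    [Algebra.FiniteType k A] (hss : HasTrivialRadical k A) {d : ℕ}
    (b : Module.Basis (Fin d) k (lieAlg k A)) : killingDet k A b ≠ 0 := by
  set K := AlgebraicClosure k
  have : CharZero K := charZero_of_injective_algebraMap (algebraMap k K).injective
  have : FiniteDimensional K (lieAlg K (K ⊗[k] A)) := .of_basis (baseChangeBasis K b)
  have hrad : LieAlgebra.radical K (lieAlg K (K ⊗[k] A)) = ⊥ := radical_lieAlg_eq_bot hss
  -- Cartan's criterion enters here: in characteristic zero, trivial radical yields the instance
  -- `LieAlgebra.IsKilling`.
  have : LieAlgebra.HasTrivialRadical K (lieAlg K (K ⊗[k] A)) := ⟨hrad⟩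
  have h := killingDet_ne_zero_of_isKilling (baseChangeBasis K b)
  rw [killingDet_baseChangeBasis] at h
  exact fun h0 => h (by rw [h0, map_zero])

/-- The Killing measure over an extension field in terms of a basis of the Lie algebra over the base
field. -/
theorem killingMeasure_baseChange {k A K : Type*} [Field k] [CommRing A] [HopfAlgebra k A]
    [Algebra.FiniteType k A] [Field K] [Algebra k K] [TopologicalSpace K] [MeasurableSpace K]
    (absK : K →*₀ ℝ≥0) (μK : Measure K) {d : ℕ} (b : Module.Basis (Fin d) k (lieAlg k A))
    (e : Module.Basis (Fin d) K (lieAlg K (K ⊗[k] A))) :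
    killingMeasure absK μK e = NNReal.sqrt (absK (algebraMap k K (killingDet k A b))) •
      formMeasure absK μK fun i => baseChangeDerivation K (b i : Derivation k A A) := by
  rw [killingMeasure_eq_of_basis absK μK e (baseChangeBasis K b), killingMeasure,
    killingDet_baseChangeBasis]
  simp only [coe_baseChangeBasis]

section

variable {k A : Type*} [Field k] [NumberField k] [CommRing A] [HopfAlgebra k A]
  [Algebra.FiniteType k A] {d : ℕ}

/-- The product of the local Killing measures is the product of the local measures of an invariant
form over `k`, by the product formula. -/
theorem killingProductMeasure_eq (b : Module.Basis (Fin d) k (lieAlg k A))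
    (hb : killingDet k A b ≠ 0)
    (eInf : ∀ v : InfinitePlace k,
      Module.Basis (Fin d) v.Completion (lieAlg v.Completion (v.Completion ⊗[k] A)))
    (eFin : ∀ v : HeightOneSpectrum (𝓞 k), Module.Basis (Fin d) (v.adicCompletion k)
      (lieAlg (v.adicCompletion k) (v.adicCompletion k ⊗[k] A))) :
    killingProductMeasure eInf eFin = productMeasure
      (fun v => formMeasure (absInf v) (haarInf v) fun i =>
        baseChangeDerivation v.Completion (b i : Derivation k A A))
      (fun v => formMeasure (absFin v) (haarFin v) fun i =>
        baseChangeDerivation (v.adicCompletion k) (b i : Derivation k A A)) := by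
  have hInf : (fun v => killingMeasure (absInf v) (haarInf v) (eInf v)) = fun v =>
      NNReal.sqrt (absInf v (algebraMap k v.Completion (killingDet k A b))) •
        formMeasure (absInf v) (haarInf v) fun i =>
          baseChangeDerivation v.Completion (b i : Derivation k A A) :=
    funext fun v => killingMeasure_baseChange (absInfHom v) (haarInf v) b (eInf v)
  have hFin : (fun v => killingMeasure (absFin v) (haarFin v) (eFin v)) = fun v =>
      NNReal.sqrt (absFin v (algebraMap k (v.adicCompletion k) (killingDet k A b))) •
        formMeasure (absFin v) (haarFin v) fun i =>
          baseChangeDerivation (v.adicCompletion k) (b i : Derivation k A A) :=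
    funext fun v => killingMeasure_baseChange (absFinHom v) (haarFin v) b (eFin v)
  have hsupp := hasFiniteMulSupport_absFin hb
  -- As a monoid homomorphism, the square root carries the product formula for `killingDet k A b` to
  -- the factors `√|δ|_v`.
  let sqrtHom : ℝ≥0 →* ℝ≥0 :=
    { toFun := NNReal.sqrt
      map_one' := NNReal.sqrt_one
      map_mul' := NNReal.sqrt_mul }
  rw [killingProductMeasure, hInf, hFin]
  refine productMeasure_smul _ _ _ _ (hsupp.subset fun v hv hv' => hv ?_) ?_
  · simp only at hv'
    simp only [hv', NNReal.sqrt_one]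
  · have h := congrArg sqrtHom (prod_absInf_mul_finprod_absFin hb)
    rw [map_mul, map_one, map_prod, sqrtHom.map_finprod hsupp] at h
    exact h

end

end AlgGroup

end

theorem mainTheorem12 {k : Type*} [Field k] [NumberField k]
    {A : Type*} [CommRing A] [HopfAlgebra k A] [Algebra.FiniteType k A]
    (hconn : IsConnectedGroup k A) (hss : HasTrivialRadical k A)
    {d : ℕ} (hd : ringKrullDim A = d)
    (b : Module.Basis (Fin d) k (lieAlg k A))
    (eInf : ∀ v : InfinitePlace k,
      Module.Basis (Fin d) v.Completion (lieAlg v.Completion (v.Completion ⊗[k] A)))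
    (eFin : ∀ v : HeightOneSpectrum (𝓞 k), Module.Basis (Fin d) (v.adicCompletion k)
      (lieAlg (v.adicCompletion k) (v.adicCompletion k ⊗[k] A))) :
    ENNReal.ofReal ((|discr k| : ℝ) ^ (-(d : ℝ) / 2)) • killingProductMeasure eInf eFin =
      tamagawaMeasure b := by
  rw [killingProductMeasure_eq b (killingDet_ne_zero hss b), tamagawaMeasure]
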